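/- Let $\mathbf S^2\subset\mathbb R^3$ be the unit sphere with surface measure $\lambda$ (total mass $4\pi$), let $Q_l$ be the Legendre polynomials, $\mathcal Y_{l,m}$ ($l\ge 0$, $|m|\le l$) the standard complex spherical harmonics, and $\mu_l=l(l+1)$. Let $T=\{T(x):x\in\mathbf S^2\}$ be a real, jointly measurable, square-integrable, zero-mean Gaussian random field on $\mathbf S^2$ whose covariance is invariant under $SO(3)$. Put $a_{l,m}=\int_{\mathbf S^2}T\,\overline{\mathcal Y_{l,m}}\,d\lambda$ and let $C_l=\frac1{2l+1}\sum_{|m|\le l}\mathbb E|a_{l,m}|^2$ (which by isotropy is the common value of $\mathbb E|a_{l,m}|^2$) be its angular power spectrum. Let $M$ be a measure on $(0,\infty)$ with $\int (y\wedge1)\,M(dy)<\infty$ and let $\Psi(\xi)=\int_0^\infty(1-e^{-\xi y})M(dy)$ be the Laplace exponent of the corresponding driftless subordinator. Let $E_\beta(x)=\sum_{k\ge0}x^k/\Gamma(\beta k+1)$ be the Mittag-Leffler function. For coefficients $\mathcal T_l(t)$ consider the field $$X_t(x)=\sum_{l\ge0}\sum_{|m|\le l}a_{l,m}\,\mathcal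 T_l(t)\,\mathcal Y_{l,m}(x),\qquad t\ge0,\ x\in\mathbf S^2,$$ where the series converges in mean square at every $(t,x)$, and the series $$\mathcal K_t(x,y)=\sum_{h\ge1}\mathbb E[X_{t+h}(x)X_t(y)],\qquad t\ge0,\ x,y\in\mathbf S^2 .$$ (0) For all $\beta\in(0,1)$ and $z\ge0$, $E_\beta(-z)\ge \dfrac1{1+\Gamma(1-\beta)z}$. (1) (Long-range dependence.) Let $\gamma\ge0$, $\beta\in(0,1)$ and $\mathcal T_l(t)=E_\beta(-t^\beta(\gamma+\Psi(\mu_l)))$, so that $X$ is the series solution of the fractional Cauchy problem $(\gamma-\mathbb D_M+\partial_t^\beta)X_t=0$, $X_0=T$, where $\mathbb D_M$ is the operator with $\mathbb D_M\mathcal Y_{l,m}=-\Psi(\mu_l)\mathcal Y_{l,m}$ and $\partial_t^\beta$ is the Caputo derivative. For all $t\ge0$, $h\in\{0,1,2,\dots\}$ and $x,y\in\mathbf S^2$, $$\mathbb E[X_{t+h}(x)X_t(y)]=\sum_{l\ge0}\frac{2l+1}{4\pi}C_l\,\mathcal T_l(t)\mathcal T_l(t+h)\,Q_l(\langle x,y\rangle),$$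 with an absolutely convergent series, and $$\mathbb E[X_{t+h}(x)X_t(x)]\ \ge\ B_t(h):=\sum_{l\ge0}\frac{2l+1}{4\pi}\,C_l\,\frac1{1+\Gamma(1-\beta)t^\beta(\gamma+\Psi(\mu_l))}\cdot\frac1{1+\Gamma(1-\beta)(t+h)^\beta(\gamma+\Psi(\mu_l))},$$ the last series being convergent. If the power spectrum is not identically zero, then $\sum_{h\ge1}B_t(h)=\infty$ for every $t\ge0$, and there is $\varepsilon>0$ such that $\mathcal K_t(x,y)=+\infty$ for all $t\ge0$ and all $x,y\in\mathbf S^2$ with $\langle x,y\rangle>1-\varepsilon$; in particular $\mathcal K_t(x,x)=+\infty$ for all $t\ge0$ and $x\in\mathbf S^2$. (2) (Short-range dependence.) Let $\gamma,\varphi\ge0$ with $\gamma>0$, or $\varphi>0$, or $M\ne0$; let $\beta\in(0,1]$, let $C_0=0$, and let $\mathcal T_l(t)=e^{-t\mu_l}(\gamma+\varphi\mu_l+\Psi(\mu_l))^{-\beta}$ for $l\ge1$ (the term $l=0$ is absent, since $a_{0,0}=0$ almost surely), so that $X$ is the series solution of $(\gamma-\mathbb D_M-\varphi\,\partial_t)^\beta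 X_t=T_t$ with $T_t=\sum_{l,m}e^{-t\mu_l}a_{l,m}\mathcal Y_{l,m}$. For all $t\ge0$, $h\in\{0,1,2,\dots\}$ and $x,y\in\mathbf S^2$, $$\mathbb E[X_{t+h}(x)X_t(y)]=\sum_{l\ge1}\frac{2l+1}{4\pi}C_l\,\mathcal T_l(t)\mathcal T_l(t+h)\,Q_l(\langle x,y\rangle),$$ with an absolutely convergent series, and $\mathcal K_t(x,y)$ converges absolutely, with $$\sum_{h\ge1}\big|\mathbb E[X_{t+h}(x)X_t(y)]\big|\le\sum_{l\ge1}\frac{2l+1}{4\pi}\,\frac{C_l}{e^{l^2}-1}\,e^{-2tl^2}\big(\gamma+\varphi l^2+\Psi(l^2)\big)^{-2\beta}\,|Q_l(\langle x,y\rangle)|<\infty .$$ -/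

import Mathlib

open MeasureTheory ProbabilityTheory Filter Topology

noncomputable section

namespace SphereField

/-- Euclidean space `ℝ³`. -/
abbrev E3 : Type := EuclideanSpace ℝ (Fin 3)

/-- The unit sphere of `ℝ³`. -/
abbrev S2 : Type := Metric.sphere (0 : E3) 1

/-- The Lebesgue (surface) measure on the unit sphere, of total mass `4π`. -/
def surf : Measure S2 := (volume : Measure E3).toSphere

/-- The action of a linear isometry of `ℝ³` on the sphere. -/
def rotate (g : E3 ≃ₗᵢ[ℝ] E3) (x : S2) : S2 :=
  ⟨g x, by simp⟩

/-! ### Spherical harmonics -/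

/-- The Legendre polynomial, by the Rodrigues formula
`Q_l(z) = (2^l l!)⁻¹ (d/dz)^l (z² - 1)^l`. -/
def legendre (l : ℕ) : Polynomial ℝ :=
  Polynomial.C (1 / (2 ^ l * (l.factorial : ℝ))) *
    Polynomial.derivative^[l] ((Polynomial.X ^ 2 - 1) ^ l)

/-- The spherical harmonic `Y_{l,m}` for an order `m ≥ 0`.  In spherical coordinates
`(sin θ)^m e^{imφ} = (x₀ + i x₁)^m` and `cos θ = x₂`, so that this is
`√((2l+1)/(4π) · (l-m)!/(l+m)!) · Q_{l,m}(cos θ) · e^{imφ}` with the associated Legendre function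
`Q_{l,m}(z) = (-1)^m (1-z²)^{m/2} (d/dz)^m Q_l(z)`; see `sphYNat_coord`. -/
def sphYNat (l m : ℕ) (x : S2) : ℂ :=
  ((Real.sqrt ((2 * l + 1) / (4 * Real.pi) *
      (((l - m).factorial : ℝ) / ((l + m).factorial : ℝ))) : ℝ) : ℂ) *
    ((-1) ^ m * (((Polynomial.derivative^[m] (legendre l)).eval (x.1 2) : ℝ) : ℂ) *
      (((x.1 0 : ℝ) : ℂ) + ((x.1 1 : ℝ) : ℂ) * Complex.I) ^ m)

/-- The spherical harmonic `Y_{l,m}`, `-l ≤ m ≤ l`, with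
`Y_{l,-m} = (-1)^m conj Y_{l,m}` for the negative orders. -/
def sphY (l : ℕ) (m : ℤ) (x : S2) : ℂ :=
  if 0 ≤ m then sphYNat l m.natAbs x
  else (-1) ^ m.natAbs * (starRingEnd ℂ) (sphYNat l m.natAbs x)

/-- The associated Legendre function `(-1)^m (1-z²)^{m/2} (d/dz)^m Q_l(z)`. -/
def assocLegendre (l m : ℕ) (z : ℝ) : ℝ :=
  (-1) ^ m * (1 - z ^ 2) ^ ((m : ℝ) / 2) * (Polynomial.derivative^[m] (legendre l)).eval z

/-- The usual formula for the spherical harmonics in spherical coordinates. -/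
theorem sphYNat_coord (l m : ℕ) (θ φ : ℝ) (h0 : 0 ≤ θ) (h1 : θ ≤ Real.pi) (x : S2)
    (hx0 : x.1 0 = Real.sin θ * Real.cos φ) (hx1 : x.1 1 = Real.sin θ * Real.sin φ)
    (hx2 : x.1 2 = Real.cos θ) :
    sphYNat l m x =
      ((Real.sqrt ((2 * l + 1) / (4 * Real.pi) *
        (((l - m).factorial : ℝ) / ((l + m).factorial : ℝ))) : ℝ) : ℂ) *
      ((assocLegendre l m (Real.cos θ) : ℝ) : ℂ) * Complex.exp (Complex.I * m * φ) := by
  have hs : 0 ≤ Real.sin θ := Real.sin_nonneg_of_nonneg_of_le_pi h0 h1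
  have e1 : (1 - Real.cos θ ^ 2) ^ ((m : ℝ) / 2) = Real.sin θ ^ m := by
    have : 1 - Real.cos θ ^ 2 = Real.sin θ ^ 2 := by
      have := Real.sin_sq_add_cos_sq θ; linarith
    rw [this, ← Real.rpow_natCast (Real.sin θ) 2, ← Real.rpow_mul hs, ← Real.rpow_natCast]
    congr 1
    push_cast; ring
  have e2 : (((x.1 0 : ℝ) : ℂ) + ((x.1 1 : ℝ) : ℂ) * Complex.I) ^ m
      = ((Real.sin θ ^ m : ℝ) : ℂ) * Complex.exp (Complex.I * m * φ) := by
    have : (((x.1 0 : ℝ) : ℂ) + ((x.1 1 : ℝ) : ℂ) * Complex.I)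
        = ((Real.sin θ : ℝ) : ℂ) * Complex.exp (φ * Complex.I) := by
      rw [hx0, hx1, Complex.exp_mul_I]; push_cast; ring
    rw [this, mul_pow, ← Complex.exp_nat_mul]
    push_cast
    congr 2
    ring
  unfold sphYNat assocLegendre
  rw [e2, e1, hx2]
  push_cast
  ring

/-! ### Isotropic Gaussian fields and their angular power spectrum -/

variable {Ω : Type*} [MeasurableSpace Ω]

/-- A (jointly measurable) square integrable, zero-mean, 2-weakly isotropic Gaussian random field
on the sphere. -/
structure IsIsotropicGaussianField (P : Measure Ω) (T : S2 → Ω → ℝ) : Prop where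
  measurable : Measurable (fun p : S2 × Ω => T p.1 p.2)
  gaussian : IsGaussianProcess T P
  sq_integrable : ∀ x, MemLp (T x) 2 P
  mean_zero : ∀ x, ∫ ω, T x ω ∂P = 0
  isotropic : ∀ g : E3 ≃ₗᵢ[ℝ] E3, LinearMap.det (g.toLinearEquiv : E3 →ₗ[ℝ] E3) = 1 →
    ∀ x y, ∫ ω, T (rotate g x) ω * T (rotate g y) ω ∂P = ∫ ω, T x ω * T y ω ∂P

/-- The random Fourier coefficient `a_{l,m} = ∫ T(x) conj(Y_{l,m}(x)) λ(dx)`. -/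
def coeff (T : S2 → Ω → ℝ) (l : ℕ) (m : ℤ) (ω : Ω) : ℂ :=
  ∫ x, (T x ω : ℂ) * (starRingEnd ℂ) (sphY l m x) ∂surf

/-- The angular power spectrum `C_l`: the mean over `|m| ≤ l` of `E|a_{l,m}|²` (for an isotropic
field this is the common value of `E|a_{l,m}|²`, `|m| ≤ l`). -/
def angularPower (P : Measure Ω) (T : S2 → Ω → ℝ) (l : ℕ) : ℝ :=
  (∑ m ∈ Finset.Icc (-(l : ℤ)) l, ∫ ω, ‖coeff T l m ω‖ ^ 2 ∂P) / (2 * l + 1)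

/-- The eigenvalue `μ_l = l(l+1)`. -/
def eig (l : ℕ) : ℝ := l * (l + 1)

/-- The partial sum `∑_{l ≤ L} ∑_{|m| ≤ l} a_{l,m} τ_l(t) Y_{l,m}(x)`. -/
def partialField (T : S2 → Ω → ℝ) (τ : ℕ → ℝ → ℝ) (L : ℕ) (t : ℝ) (x : S2) (ω : Ω) : ℂ :=
  ∑ l ∈ Finset.range (L + 1), ∑ m ∈ Finset.Icc (-(l : ℤ)) l,
    coeff T l m ω * (τ l t : ℂ) * sphY l m x

/-- `X_t(x) = ∑_{l,m} a_{l,m} τ_l(t) Y_{l,m}(x)`, with mean-square convergence for every `t ≥ 0`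
and every point `x` of the sphere. -/
def IsFieldSeries (P : Measure Ω) (T : S2 → Ω → ℝ) (τ : ℕ → ℝ → ℝ) (X : ℝ → S2 → Ω → ℝ) : Prop :=
  ∀ t : ℝ, 0 ≤ t → ∀ x : S2, MemLp (X t x) 2 P ∧
    Tendsto (fun L : ℕ => eLpNorm (fun ω => (X t x ω : ℂ) - partialField T τ L t x ω) 2 P)
      atTop (𝓝 0)

/-! ### Subordinators, the Mittag-Leffler function, and the two solutions -/

/-- Lévy measures of subordinators: carried by `(0,∞)` and integrating `y ∧ 1`. -/
structure IsSubordinatorMeasure (M : Measure ℝ) : Prop where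
  pos : M (Set.Iic 0) = 0
  finite : ∫⁻ y, ENNReal.ofReal (min y 1) ∂M < ⊤

/-- The Laplace exponent `Ψ(ξ) = ∫ (1 - e^{-ξy}) M(dy)` of the driftless subordinator. -/
def laplaceExp (M : Measure ℝ) (ξ : ℝ) : ℝ := ∫ y, (1 - Real.exp (-(ξ * y))) ∂M

/-- The Mittag-Leffler function `E_β`. -/
def mittagLeffler (β x : ℝ) : ℝ := ∑' k : ℕ, x ^ k / Real.Gamma (β * k + 1)

/-- Time coefficients of the solution of `(γ - D_M + ∂^β/∂t^β) X = 0`, `X_0 = T`. -/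
def caputoCoeff (M : Measure ℝ) (γ β : ℝ) (l : ℕ) (t : ℝ) : ℝ :=
  mittagLeffler β (-(t ^ β * (γ + laplaceExp M (eig l))))

/-- Time coefficients of the solution of `(γ - D_M - φ ∂/∂t)^β X_t = T_t`, where
`T_t = ∑ e^{-tμ_l} a_{l,m} Y_{l,m}`. -/
def powerCoeff (M : Measure ℝ) (γ φ β : ℝ) (l : ℕ) (t : ℝ) : ℝ :=
  Real.exp (-(t * eig l)) * (γ + φ * eig l + laplaceExp M (eig l)) ^ (-β)

/-- The covariance `E[X_{t+h}(x) X_t(y)]`. -/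
def lagCov (P : Measure Ω) (X : ℝ → S2 → Ω → ℝ) (t : ℝ) (x y : S2) (h : ℕ) : ℝ :=
  ∫ ω, X (t + h) x ω * X t y ω ∂P

/-- The lower bound `∑_l (2l+1)/(4π) C_l (1+Γ(1-β)t^β(γ+Ψ(μ_l)))⁻¹ (1+Γ(1-β)(t+h)^β(γ+Ψ(μ_l)))⁻¹`,
`l`-th term. -/
def lowerTerm (P : Measure Ω) (T : S2 → Ω → ℝ) (M : Measure ℝ) (γ β t : ℝ) (h l : ℕ) : ℝ :=
  (2 * l + 1) / (4 * Real.pi) * angularPower P T l *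
    (1 / (1 + Real.Gamma (1 - β) * t ^ β * (γ + laplaceExp M (eig l)))) *
    (1 / (1 + Real.Gamma (1 - β) * (t + h) ^ β * (γ + laplaceExp M (eig l))))

/-- The `l`-th term (`l ≥ 1`) of the upper bound in the short-range case. -/
def upperTerm (P : Measure Ω) (T : S2 → Ω → ℝ) (M : Measure ℝ) (γ φ β t : ℝ) (x y : S2)
    (l : ℕ) : ℝ :=
  (2 * l + 1) / (4 * Real.pi) * (angularPower P T l / (Real.exp ((l : ℝ) ^ 2) - 1)) *
    Real.exp (-(2 * t * (l : ℝ) ^ 2)) *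
    (γ + φ * (l : ℝ) ^ 2 + laplaceExp M ((l : ℝ) ^ 2)) ^ (-(2 * β)) *
    |(legendre l).eval (inner ℝ x.1 y.1)|

end SphereField

end

noncomputable section

namespace SphereField

/-! ### The Mittag-Leffler function -/

theorem pow_le_mul_Gamma {A x : ℝ} (hA : 1 ≤ A) (hx : 1 ≤ x) :
    A ^ (x - 1) ≤ Real.exp (A + 1) * Real.Gamma x := by
  have hx0 : 0 < x := by linarith
  have hI := Real.GammaIntegral_convergent hx0
  have h1 : ∫ u in Set.Ioc A (A + 1), Real.exp (-(A + 1)) * A ^ (x - 1) ≤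
      ∫ u in Set.Ioc A (A + 1), Real.exp (-u) * u ^ (x - 1) := by
    apply setIntegral_mono_on
    · exact integrableOn_const (by simp)
    · exact hI.mono_set (fun u hu => by
        have := hu.1
        exact Set.mem_Ioi.2 (by linarith))
    · exact measurableSet_Ioc
    · intro u hu
      have h1 := hu.1
      have h2 := hu.2
      gcongr
  have h2 : ∫ u in Set.Ioc A (A + 1), Real.exp (-u) * u ^ (x - 1) ≤ Real.Gamma x := by
    rw [Real.Gamma_eq_integral hx0]
    apply setIntegral_mono_set hI
    · filter_upwards [ae_restrict_mem measurableSet_Ioi] with u hu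
      have : (0 : ℝ) < u := hu
      simp only [Pi.zero_apply]
      positivity
    · exact (show Set.Ioc A (A + 1) ⊆ Set.Ioi 0 from fun u hu => by
        have := hu.1
        exact Set.mem_Ioi.2 (by linarith)).eventuallyLE
  have h3 : ∫ u in Set.Ioc A (A + 1), Real.exp (-(A + 1)) * A ^ (x - 1) =
      Real.exp (-(A + 1)) * A ^ (x - 1) := by
    simp
  have h4 := (h3.symm.trans_le h1).trans h2
  calc A ^ (x - 1) = Real.exp (A + 1) * (Real.exp (-(A + 1)) * A ^ (x - 1)) := by
        rw [← mul_assoc, ← Real.exp_add]; simp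
    _ ≤ _ := by gcongr

theorem summable_pow_div_Gamma {β α : ℝ} (hβ : 0 < β) (hα : 0 < α) (R : ℝ) (hR : 0 ≤ R) :
    Summable (fun k : ℕ => R ^ k / Real.Gamma (β * k + α)) := by
  obtain ⟨A, hA1, hA2⟩ : ∃ A : ℝ, 1 ≤ A ∧ 2 * R + 1 ≤ A ^ β := by
    refine ⟨(2 * R + 1) ^ (1 / β), Real.one_le_rpow (by linarith) (by positivity), ?_⟩
    rw [← Real.rpow_mul (by linarith)]
    simp [hβ.ne']
  have hA0 : 0 < A := by linarith
  obtain ⟨N, hN⟩ := exists_nat_ge (1 / β)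
  refine (summable_nat_add_iff N).1 ?_
  have hgeo : Summable (fun k : ℕ => (Real.exp (A + 1) / A ^ (α - 1)) * (1 / 2 : ℝ) ^ (k + N)) :=
    ((summable_nat_add_iff N).2 summable_geometric_two).mul_left _
  refine Summable.of_nonneg_of_le (fun k => ?_) (fun k => ?_) hgeo
  · have : 0 < Real.Gamma (β * ((k + N : ℕ) : ℝ) + α) := Real.Gamma_pos_of_pos (by positivity)
    positivity
  · set n := k + N with hn
    have hbn : 1 ≤ β * n + α := by
      have h1 : 1 / β ≤ (n : ℝ) := hN.trans (by
        rw [hn]; push_cast; linarith [Nat.cast_nonneg (α := ℝ) k])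
      rw [div_le_iff₀ hβ] at h1
      nlinarith
    have hG : 0 < Real.Gamma (β * n + α) := Real.Gamma_pos_of_pos (by linarith)
    have key := pow_le_mul_Gamma hA1 hbn
    have e : A ^ (β * n + α - 1) = (A ^ β) ^ n * A ^ (α - 1) := by
      rw [add_sub_assoc, Real.rpow_add hA0, Real.rpow_mul hA0.le, Real.rpow_natCast]
    rw [e] at key
    rw [div_le_iff₀ hG]
    have h5 : (2 * R) ^ n ≤ (A ^ β) ^ n := by gcongr; linarith
    have hp : 0 < A ^ (α - 1) := by positivity
    have h6 : (2 * R) ^ n ≤ Real.exp (A + 1) * Real.Gamma (β * n + α) / A ^ (α - 1) := by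
      rw [le_div_iff₀ hp]
      exact (mul_le_mul_of_nonneg_right h5 hp.le).trans key
    calc R ^ n = (2 * R) ^ n * (1 / 2) ^ n := by rw [← mul_pow]; congr 1; ring
      _ ≤ Real.exp (A + 1) * Real.Gamma (β * n + α) / A ^ (α - 1) * (1 / 2) ^ n := by gcongr
      _ = _ := by ring

/-- The two-parameter Mittag-Leffler function `E_{β,α}`. -/
def mlTwo (β α z : ℝ) : ℝ := ∑' k : ℕ, z ^ k / Real.Gamma (β * k + α)

theorem summable_mlTwo {β α : ℝ} (hβ : 0 < β) (hα : 0 < α) (z : ℝ) :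
    Summable (fun k : ℕ => z ^ k / Real.Gamma (β * k + α)) := by
  refine Summable.of_norm ((summable_pow_div_Gamma hβ hα |z| (abs_nonneg _)).congr fun k => ?_)
  have : 0 < Real.Gamma (β * k + α) := Real.Gamma_pos_of_pos (by positivity)
  rw [norm_div, norm_pow, Real.norm_eq_abs, Real.norm_eq_abs, abs_of_pos this]

theorem continuous_mlTwo {β α : ℝ} (hβ : 0 < β) (hα : 0 < α) : Continuous (mlTwo β α) := by
  rw [continuous_iff_continuousAt]
  intro z
  have h : ContinuousOn (mlTwo β α) (Metric.ball 0 (|z| + 1)) := by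
    refine continuousOn_tsum (fun k => by fun_prop)
      (summable_pow_div_Gamma hβ hα (|z| + 1) (by positivity)) ?_
    intro k w hw
    have : 0 < Real.Gamma (β * k + α) := Real.Gamma_pos_of_pos (by positivity)
    rw [norm_div, norm_pow, Real.norm_of_nonneg this.le]
    gcongr
    exact (mem_ball_zero_iff.1 hw).le
  exact h.continuousAt (Metric.isOpen_ball.mem_nhds (by simp))

theorem mlTwo_zero (β α : ℝ) : mlTwo β α 0 = 1 / Real.Gamma α := by
  rw [mlTwo, tsum_eq_single 0]
  · simp
  · intro k hk; simp [hk]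

theorem mlTwo_eq_add {β α : ℝ} (hβ : 0 < β) (hα : 0 < α) (z : ℝ) :
    mlTwo β α z = 1 / Real.Gamma α + z * mlTwo β (α + β) z := by
  rw [mlTwo, (summable_mlTwo hβ hα z).tsum_eq_zero_add, mlTwo, ← tsum_mul_left]
  congr 1
  · simp
  · refine tsum_congr fun k => ?_
    rw [pow_succ', mul_div_assoc]
    congr 3
    push_cast; ring

theorem integral_rpow_mul_rpow_sub {a b t : ℝ} (ha : 0 < a) (hb : 0 < b) (ht : 0 < t) :
    ∫ s in (0 : ℝ)..t, s ^ (a - 1) * (t - s) ^ (b - 1) =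
      t ^ (a + b - 1) * (Real.Gamma a * Real.Gamma b / Real.Gamma (a + b)) := by
  have h := Complex.betaIntegral_scaled (a : ℂ) (b : ℂ) ht
  rw [Complex.betaIntegral_eq_Gamma_mul_div _ _ (by simpa) (by simpa)] at h
  have e : ∀ s ∈ Set.uIcc 0 t, ((s : ℂ) ^ ((a : ℂ) - 1) * ((t : ℂ) - s) ^ ((b : ℂ) - 1)) =
      ((s ^ (a - 1) * (t - s) ^ (b - 1) : ℝ) : ℂ) := by
    intro s hs
    rw [Set.uIcc_of_le ht.le] at hs
    rw [Complex.ofReal_mul, Complex.ofReal_cpow hs.1, Complex.ofReal_cpow (sub_nonneg.2 hs.2)]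
    push_cast
    rfl
  rw [intervalIntegral.integral_congr e, intervalIntegral.integral_ofReal] at h
  rw [← Complex.ofReal_inj, h]
  rw [← Complex.ofReal_add, Complex.Gamma_ofReal, Complex.Gamma_ofReal, Complex.Gamma_ofReal]
  push_cast
  rw [Complex.ofReal_cpow ht.le]
  push_cast
  rfl

theorem intervalIntegrable_rpow_mul_rpow_sub {a b t : ℝ} (ha : 0 < a) (hb : 0 < b) (ht : 0 < t) :
    IntervalIntegrable (fun s => s ^ (a - 1) * (t - s) ^ (b - 1)) volume 0 t := by
  by_contra hn
  have h := integral_rpow_mul_rpow_sub ha hb ht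
  rw [intervalIntegral.integral_undef hn] at h
  have : 0 < t ^ (a + b - 1) * (Real.Gamma a * Real.Gamma b / Real.Gamma (a + b)) := by
    have h1 := Real.Gamma_pos_of_pos ha
    have h2 := Real.Gamma_pos_of_pos hb
    have h3 := Real.Gamma_pos_of_pos (add_pos ha hb)
    positivity
  linarith

/-- `t ^ (α - 1) E_{β,α}(-t ^ β)`. -/
def mlKer (β α t : ℝ) : ℝ := t ^ (α - 1) * mlTwo β α (-t ^ β)

theorem continuousOn_mlKer {β α : ℝ} (hβ : 0 < β) (hα : 0 < α) :
    ContinuousOn (mlKer β α) (Set.Ioi 0) := by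
  apply ContinuousOn.mul
  · exact fun t ht => (Real.continuousAt_rpow_const _ _ (Or.inl (ne_of_gt ht))).continuousWithinAt
  · exact ((continuous_mlTwo hβ hα).comp
      (Real.continuous_rpow_const hβ.le).neg).continuousOn

theorem intervalIntegrable_mlKer_conv {β a b t : ℝ} (hβ : 0 < β) (ha : 0 < a) (hb : 0 < b)
    (ht : 0 < t) :
    IntervalIntegrable (fun s => mlKer β a s * (t - s) ^ (b - 1)) volume 0 t := by
  have h := (intervalIntegrable_rpow_mul_rpow_sub ha hb ht).mul_continuousOn
    (g := fun s => mlTwo β a (-s ^ β))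
    ((continuous_mlTwo hβ ha).comp (Real.continuous_rpow_const hβ.le).neg).continuousOn
  refine h.congr ?_
  intro s _
  simp only [mlKer]
  ring

theorem integral_mlKer_conv {β a b t : ℝ} (hβ : 0 < β) (ha : 0 < a) (hb : 0 < b) (ht : 0 < t) :
    ∫ s in (0 : ℝ)..t, mlKer β a s * (t - s) ^ (b - 1) = Real.Gamma b * mlKer β (a + b) t := by
  have hG : ∀ k : ℕ, 0 < Real.Gamma (β * k + a) := fun k => Real.Gamma_pos_of_pos (by positivity)
  have hS := summable_pow_div_Gamma hβ ha (t ^ β) (by positivity)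
  have key := intervalIntegral.hasSum_integral_of_dominated_convergence (μ := volume) (a := 0)
    (b := t) (F := fun (k : ℕ) s => (s ^ (a - 1) * (t - s) ^ (b - 1)) *
      ((-s ^ β) ^ k / Real.Gamma (β * k + a)))
    (f := fun s => mlKer β a s * (t - s) ^ (b - 1))
    (fun (k : ℕ) s => (s ^ (a - 1) * (t - s) ^ (b - 1)) * ((t ^ β) ^ k / Real.Gamma (β * k + a)))
    (fun k => Measurable.aestronglyMeasurable (by fun_prop))
    (fun k => Eventually.of_forall fun s hs => ?_)
    (Eventually.of_forall fun s hs => hS.mul_left _)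
    ?_
    (Eventually.of_forall fun s hs => ?_)
  · rw [← key.tsum_eq, mlKer, mlTwo, ← tsum_mul_left, ← tsum_mul_left]
    refine tsum_congr fun k => ?_
    have hk : 0 < β * k + a := by positivity
    have e : ∀ s ∈ Set.uIoc 0 t, (s ^ (a - 1) * (t - s) ^ (b - 1)) *
        ((-s ^ β) ^ k / Real.Gamma (β * k + a)) =
        ((-1) ^ k / Real.Gamma (β * k + a)) * (s ^ (β * k + a - 1) * (t - s) ^ (b - 1)) := by
      intro s hs
      rw [Set.uIoc_of_le ht.le] at hs
      have : s ^ (β * k + a - 1) = (s ^ β) ^ k * s ^ (a - 1) := by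
        rw [add_sub_assoc, Real.rpow_add hs.1, Real.rpow_mul hs.1.le, Real.rpow_natCast]
      rw [this, neg_pow (s ^ β)]
      ring
    rw [intervalIntegral.integral_congr_ae (Eventually.of_forall e),
      intervalIntegral.integral_const_mul,
      integral_rpow_mul_rpow_sub hk hb ht]
    have h2 : t ^ (β * k + a + b - 1) = (t ^ β) ^ k * t ^ (a + b - 1) := by
      rw [add_assoc, add_sub_assoc, Real.rpow_add ht, Real.rpow_mul ht.le, Real.rpow_natCast]
    rw [h2, neg_pow (t ^ β), add_assoc]
    have h3 := (hG k).ne'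
    have h4 : Real.Gamma (β * k + (a + b)) ≠ 0 := (Real.Gamma_pos_of_pos (by positivity)).ne'
    field_simp
  · rw [Set.uIoc_of_le ht.le] at hs
    have h0 : 0 < s := hs.1
    have h1 : 0 ≤ t - s := sub_nonneg.2 hs.2
    rw [norm_mul, norm_div, norm_pow, norm_neg, Real.norm_of_nonneg (hG k).le,
      Real.norm_of_nonneg (by positivity), Real.norm_of_nonneg (by positivity)]
    have := hG k
    gcongr
    exact hs.2
  · refine ((intervalIntegrable_rpow_mul_rpow_sub ha hb ht).mul_const
      (∑' k : ℕ, (t ^ β) ^ k / Real.Gamma (β * k + a))).congr fun s _ => ?_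
    exact tsum_mul_left.symm
  · have := ((summable_mlTwo hβ ha (-s ^ β)).hasSum).mul_left (s ^ (a - 1) * (t - s) ^ (b - 1))
    rwa [show s ^ (a - 1) * (t - s) ^ (b - 1) * ∑' k : ℕ, (-s ^ β) ^ k / Real.Gamma (β * k + a) =
      mlKer β a s * (t - s) ^ (b - 1) by rw [mlKer, mlTwo]; ring] at this

theorem mlKer_add_mlKer {β t : ℝ} (hβ : 0 < β) (ht : 0 < t) :
    mlKer β β t + mlKer β (β + β) t = t ^ (β - 1) / Real.Gamma β := by
  have e : t ^ (β + β - 1) = t ^ (β - 1) * t ^ β := by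
    rw [← Real.rpow_add ht]; congr 1; ring
  rw [mlKer, mlKer, mlTwo_eq_add hβ hβ, e]
  ring

theorem mlKer_pos {β t : ℝ} (hβ : 0 < β) (hβ1 : β < 1) (ht : 0 < t) : 0 < mlKer β β t := by
  by_contra hneg
  have hcE : Continuous (fun s : ℝ => mlTwo β β (-s ^ β)) :=
    (continuous_mlTwo hβ hβ).comp (Real.continuous_rpow_const hβ.le).neg
  have hΓ : 0 < Real.Gamma β := Real.Gamma_pos_of_pos hβ
  -- the first point where the kernel fails to be positive
  obtain ⟨t0, ht0, hr0, hpos⟩ : ∃ t0 : ℝ, 0 < t0 ∧ mlKer β β t0 ≤ 0 ∧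
      ∀ s, 0 < s → s < t0 → 0 < mlKer β β s := by
    set S : Set ℝ := Set.Ici 0 ∩ {s | mlTwo β β (-s ^ β) ≤ 0} with hS
    have hSc : IsClosed S := isClosed_Ici.inter (isClosed_le hcE continuous_const)
    have hSb : BddBelow S := ⟨0, fun s hs => hs.1⟩
    have hSn : S.Nonempty := by
      refine ⟨t, ht.le, ?_⟩
      by_contra h
      exact hneg (mul_pos (by positivity) (not_le.1 h))
    have hm := hSc.csInf_mem hSn hSb
    have h0 : 0 < sInf S := by
      rcases (show (0 : ℝ) ≤ sInf S from hm.1).eq_or_lt with h | h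
      · have h1 := hm.2
        rw [← h, Set.mem_ofPred_eq, Real.zero_rpow hβ.ne', neg_zero, mlTwo_zero] at h1
        exact absurd h1 (not_le.2 (by positivity))
      · exact h
    refine ⟨sInf S, h0, mul_nonpos_of_nonneg_of_nonpos (by positivity) hm.2, fun s hs hs1 => ?_⟩
    refine mul_pos (by positivity) ?_
    by_contra h
    exact absurd (csInf_le hSb (show s ∈ S from ⟨hs.le, not_lt.1 h⟩)) (not_le.2 hs1)
  have hG1 : 0 < Real.Gamma (β + 1) := Real.Gamma_pos_of_pos (by linarith)
  obtain ⟨t', ht'0, ht't0, ht'⟩ : ∃ t' : ℝ, 0 < t' ∧ t' < t0 ∧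
      (t0 - t') ^ β / Real.Gamma (β + 1) < (t' / t0) ^ (1 - β) := by
    have h1 : Tendsto (fun s : ℝ => (t0 - s) ^ β / Real.Gamma (β + 1)) (𝓝[<] t0) (𝓝 0) := by
      have : Continuous (fun s : ℝ => (t0 - s) ^ β / Real.Gamma (β + 1)) :=
        ((Real.continuous_rpow_const hβ.le).comp (by fun_prop)).div_const _
      have h := this.tendsto t0
      simp only [sub_self, Real.zero_rpow hβ.ne', zero_div] at h
      exact h.mono_left nhdsWithin_le_nhds
    have h2 : Tendsto (fun s : ℝ => (s / t0) ^ (1 - β)) (𝓝[<] t0) (𝓝 1) := by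
      have : Continuous (fun s : ℝ => (s / t0) ^ (1 - β)) :=
        (Real.continuous_rpow_const (by linarith)).comp (by fun_prop)
      have h := this.tendsto t0
      simp only [div_self ht0.ne', Real.one_rpow] at h
      exact h.mono_left nhdsWithin_le_nhds
    have h3 := h1.eventually_lt h2 zero_lt_one
    have h4 : ∀ᶠ s in 𝓝[<] t0, 0 < s := nhdsWithin_le_nhds (lt_mem_nhds ht0)
    obtain ⟨s, hs1, hs2, hs3⟩ := (h3.and (h4.and self_mem_nhdsWithin)).exists
    exact ⟨s, hs2, hs3, hs1⟩
  obtain ⟨u, hu, humax⟩ := isCompact_Icc.exists_isMaxOn (Set.nonempty_Icc.2 ht't0.le)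
    ((continuousOn_mlKer hβ hβ).mono (fun s (hs : s ∈ Set.Icc t' t0) =>
      Set.mem_Ioi.2 (ht'0.trans_le hs.1)))
  have hu0 : 0 < u := ht'0.trans_le hu.1
  have hru : 0 < mlKer β β u :=
    (hpos t' ht'0 ht't0).trans_le (humax (Set.left_mem_Icc.2 ht't0.le))
  have hut0 : u < t0 := hu.2.lt_of_ne (by rintro rfl; linarith)
  have hi0 := intervalIntegrable_mlKer_conv hβ hβ hβ ht0
  have hia : IntervalIntegrable (fun s => mlKer β β s * (t0 - s) ^ (β - 1)) volume 0 u :=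
    hi0.mono_set (by
      rw [Set.uIcc_of_le ht0.le, Set.uIcc_of_le hu0.le]; exact Set.Icc_subset_Icc_right hu.2)
  have hib : IntervalIntegrable (fun s => mlKer β β s * (t0 - s) ^ (β - 1)) volume u t0 :=
    hi0.mono_set (by
      rw [Set.uIcc_of_le ht0.le, Set.uIcc_of_le hu.2]; exact Set.Icc_subset_Icc_left hu0.le)
  have hiu := intervalIntegrable_mlKer_conv hβ hβ hβ hu0
  have hsplit := intervalIntegral.integral_add_adjacent_intervals hia hib
  rw [integral_mlKer_conv hβ hβ hβ ht0] at hsplit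
  have h1 : ∫ s in (0 : ℝ)..u, mlKer β β s * (t0 - s) ^ (β - 1) ≤
      ∫ s in (0 : ℝ)..u, (t0 / u) ^ (β - 1) * (mlKer β β s * (u - s) ^ (β - 1)) := by
    refine intervalIntegral.integral_mono_on_of_le_Ioo hu0.le hia (hiu.const_mul _) fun s hs => ?_
    have hrs := hpos s hs.1 (hs.2.trans hut0)
    have hsu : 0 < u - s := sub_pos.2 hs.2
    have : (t0 - s) ^ (β - 1) ≤ (t0 / u) ^ (β - 1) * (u - s) ^ (β - 1) := by
      rw [← Real.mul_rpow (by positivity) hsu.le]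
      apply Real.rpow_le_rpow_of_nonpos (by positivity) _ (by linarith)
      rw [div_mul_eq_mul_div, div_le_iff₀ hu0]
      nlinarith [hs.1]
    calc mlKer β β s * (t0 - s) ^ (β - 1)
        ≤ mlKer β β s * ((t0 / u) ^ (β - 1) * (u - s) ^ (β - 1)) := by gcongr
      _ = _ := by ring
  rw [intervalIntegral.integral_const_mul, integral_mlKer_conv hβ hβ hβ hu0] at h1
  have hpow : ∫ s in u..t0, (t0 - s) ^ (β - 1) = (t0 - u) ^ β / β := by
    rw [intervalIntegral.integral_comp_sub_left (fun x => x ^ (β - 1)), sub_self,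
      integral_rpow (Or.inl (by linarith))]
    simp [Real.zero_rpow hβ.ne']
  have hipow : IntervalIntegrable (fun s => (t0 - s) ^ (β - 1)) volume u t0 := by
    have := (intervalIntegral.intervalIntegrable_rpow' (a := t0 - u) (b := 0)
      (show -1 < β - 1 by linarith)).comp_sub_left t0
    simpa using this
  have h2 : ∫ s in u..t0, mlKer β β s * (t0 - s) ^ (β - 1) ≤
      mlKer β β u * ((t0 - u) ^ β / β) := by
    rw [← hpow, ← intervalIntegral.integral_const_mul]
    refine intervalIntegral.integral_mono_on hut0.le hib (hipow.const_mul _) fun s hs => ?_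
    have := sub_nonneg.2 hs.2
    gcongr
    exact humax ⟨hu.1.trans hs.1, hs.2⟩
  have e0 := mlKer_add_mlKer hβ ht0
  have eu := mlKer_add_mlKer hβ hu0
  have h3 : (t0 / u) ^ (β - 1) * (u ^ (β - 1) / Real.Gamma β) = t0 ^ (β - 1) / Real.Gamma β := by
    rw [← mul_div_assoc, ← Real.mul_rpow (by positivity) hu0.le, div_mul_cancel₀ _ hu0.ne']
  have h4 : (t0 / u) ^ (β - 1) = (u / t0) ^ (1 - β) := by
    rw [← inv_div, Real.inv_rpow (by positivity), ← Real.rpow_neg (by positivity)]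
    congr 1; ring
  have h5 : (t0 - u) ^ β / Real.Gamma (β + 1) < (u / t0) ^ (1 - β) := by
    refine lt_of_le_of_lt ?_ (ht'.trans_le ?_)
    · have := sub_pos.2 hut0
      gcongr
      exact hu.1
    · have : 0 ≤ 1 - β := by linarith
      gcongr
      exact hu.1
  have h6 : mlKer β (β + β) t0 ≤ (t0 / u) ^ (β - 1) * mlKer β (β + β) u +
      mlKer β β u * ((t0 - u) ^ β / Real.Gamma (β + 1)) := by
    rw [Real.Gamma_add_one hβ.ne']
    have h7 : Real.Gamma β * mlKer β (β + β) t0 ≤ Real.Gamma β *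
        ((t0 / u) ^ (β - 1) * mlKer β (β + β) u +
          mlKer β β u * ((t0 - u) ^ β / (β * Real.Gamma β))) := by
      calc _ ≤ _ := hsplit.symm.trans_le (add_le_add h1 h2)
        _ = _ := by field_simp
    exact le_of_mul_le_mul_left h7 hΓ
  rw [← h4] at h5
  have h8 : mlKer β (β + β) u = u ^ (β - 1) / Real.Gamma β - mlKer β β u := by linarith
  rw [h8, mul_sub, h3] at h6
  have h9 := mul_lt_mul_of_pos_left h5 hru
  nlinarith

theorem one_sub_mlKer_one {β t : ℝ} (hβ : 0 < β) (ht : 0 < t) :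
    1 - mlKer β 1 t = ∫ s in (0 : ℝ)..t, mlKer β β s := by
  have h := integral_mlKer_conv hβ hβ one_pos ht
  simp only [sub_self, Real.rpow_zero, mul_one, Real.Gamma_one, one_mul] at h
  rw [h, mlKer, mlKer, mlTwo_eq_add hβ one_pos, add_comm β 1]
  simp

theorem intervalIntegrable_mlKer {β t : ℝ} (hβ : 0 < β) (ht : 0 < t) :
    IntervalIntegrable (mlKer β β) volume 0 t := by
  simpa using intervalIntegrable_mlKer_conv hβ hβ one_pos ht

theorem mittagLeffler_eq_mlKer {β z : ℝ} (hβ : 0 < β) (hz : 0 ≤ z) :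
    mittagLeffler β (-z) = mlKer β 1 (z ^ (1 / β)) := by
  have h : (z ^ (1 / β)) ^ β = z := by
    rw [← Real.rpow_mul hz, one_div_mul_cancel hβ.ne', Real.rpow_one]
  rw [mlKer, h]
  simp [mittagLeffler, mlTwo]

theorem mlKer_one_antitone {β s t : ℝ} (hβ : 0 < β) (hβ1 : β < 1) (hs : 0 < s) (hst : s ≤ t) :
    mlKer β 1 t ≤ mlKer β 1 s := by
  have h1 := one_sub_mlKer_one hβ hs
  have h2 := one_sub_mlKer_one hβ (hs.trans_le hst)
  have h3 : ∫ u in (0 : ℝ)..s, mlKer β β u ≤ ∫ u in (0 : ℝ)..t, mlKer β β u := by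
    refine intervalIntegral.integral_mono_interval le_rfl hs.le hst ?_
      (intervalIntegrable_mlKer hβ (hs.trans_le hst))
    filter_upwards [ae_restrict_mem measurableSet_Ioc] with u hu
    exact (mlKer_pos hβ hβ1 hu.1).le
  linarith

theorem le_mlKer_one {β t : ℝ} (hβ : 0 < β) (hβ1 : β < 1) (ht : 0 < t) :
    1 / (1 + Real.Gamma (1 - β) * t ^ β) ≤ mlKer β 1 t := by
  have hb : 0 < 1 - β := by linarith
  have hΓ := Real.Gamma_pos_of_pos hb
  have h1 := integral_mlKer_conv hβ hβ hb ht
  have h2 : ∫ s in (0 : ℝ)..t, mlKer β β s * t ^ (-β) ≤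
      ∫ s in (0 : ℝ)..t, mlKer β β s * (t - s) ^ (1 - β - 1) := by
    refine intervalIntegral.integral_mono_on_of_le_Ioo ht.le
      ((intervalIntegrable_mlKer hβ ht).mul_const _)
      (intervalIntegrable_mlKer_conv hβ hβ hb ht) fun s hs => ?_
    refine mul_le_mul_of_nonneg_left ?_ (mlKer_pos hβ hβ1 hs.1).le
    rw [show 1 - β - 1 = -β by ring]
    exact Real.rpow_le_rpow_of_nonpos (sub_pos.2 hs.2) (by linarith [hs.1]) (by linarith)
  rw [intervalIntegral.integral_mul_const, ← one_sub_mlKer_one hβ ht, h1,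
    show β + (1 - β) = 1 by ring, Real.rpow_neg ht.le, ← div_eq_mul_inv,
    div_le_iff₀ (by positivity)] at h2
  rw [div_le_iff₀ (by positivity)]
  linarith

/-- The lower bound for the Mittag-Leffler function on the negative half-line. -/
theorem le_mittagLeffler {β z : ℝ} (hβ : 0 < β) (hβ1 : β < 1) (hz : 0 ≤ z) :
    1 / (1 + Real.Gamma (1 - β) * z) ≤ mittagLeffler β (-z) := by
  rcases hz.eq_or_lt with rfl | hz0
  · have := mlTwo_zero β 1
    simp only [mlTwo] at this
    simp [mittagLeffler, this]
  · rw [mittagLeffler_eq_mlKer hβ hz]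
    have h := le_mlKer_one hβ hβ1 (t := z ^ (1 / β)) (by positivity)
    rwa [← Real.rpow_mul hz, one_div_mul_cancel hβ.ne', Real.rpow_one] at h

theorem mittagLeffler_zero (β : ℝ) : mittagLeffler β 0 = 1 := by
  have := mlTwo_zero β 1
  simpa [mlTwo, mittagLeffler] using this

theorem mittagLeffler_neg_antitone {β w z : ℝ} (hβ : 0 < β) (hβ1 : β < 1) (hw : 0 ≤ w)
    (hwz : w ≤ z) : mittagLeffler β (-z) ≤ mittagLeffler β (-w) := by
  rcases hw.eq_or_lt with rfl | hw0
  · rcases hwz.eq_or_lt with rfl | hz0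
    · rfl
    · have ht : 0 < z ^ (1 / β) := by positivity
      have h := one_sub_mlKer_one hβ ht
      have h1 : 0 ≤ ∫ s in (0 : ℝ)..z ^ (1 / β), mlKer β β s := by
        rw [intervalIntegral.integral_of_le ht.le]
        exact setIntegral_nonneg measurableSet_Ioc fun s hs => (mlKer_pos hβ hβ1 hs.1).le
      rw [mittagLeffler_eq_mlKer hβ hz0.le, neg_zero, mittagLeffler_zero]
      linarith
  · rw [mittagLeffler_eq_mlKer hβ hw, mittagLeffler_eq_mlKer hβ (hw.trans hwz)]
    exact mlKer_one_antitone hβ hβ1 (by positivity) (by gcongr)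

theorem mittagLeffler_neg_pos {β z : ℝ} (hβ : 0 < β) (hβ1 : β < 1) (hz : 0 ≤ z) :
    0 < mittagLeffler β (-z) := by
  have := Real.Gamma_pos_of_pos (show 0 < 1 - β by linarith)
  exact lt_of_lt_of_le (by positivity) (le_mittagLeffler hβ hβ1 hz)

/-! ### Legendre polynomials -/

section Legendre

open Polynomial

theorem rodrigues_derivative (l : ℕ) :
    (X ^ 2 - 1 : ℝ[X]) * derivative ((X ^ 2 - 1) ^ l) = C (2 * l : ℝ) * X * (X ^ 2 - 1) ^ l := by
  rcases l with _ | l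
  · simp
  · rw [derivative_pow_succ]
    simp only [derivative_sub, derivative_pow, derivative_X, derivative_one, C_mul, map_add,
      Nat.cast_add, Nat.cast_one, map_natCast, map_one, map_ofNat]
    push_cast
    ring

theorem rodrigues_ode (l n : ℕ) :
    (X ^ 2 - 1 : ℝ[X]) * derivative^[n + 2] ((X ^ 2 - 1) ^ l) +
      C (2 * (n + 1 - l) : ℝ) * X * derivative^[n + 1] ((X ^ 2 - 1) ^ l) +
      C ((n + 1) * (n - 2 * l) : ℝ) * derivative^[n] ((X ^ 2 - 1) ^ l) = 0 := by
  induction n with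
  | zero =>
    have h := congrArg derivative (rodrigues_derivative l)
    simp only [derivative_mul, derivative_sub, derivative_X_sq, derivative_one, derivative_C,
      derivative_X] at h
    simp only [Function.iterate_succ_apply', Function.iterate_zero_apply]
    simp only [map_mul, map_sub, map_add, map_ofNat, map_natCast, map_one, map_zero,
      Nat.cast_zero] at h ⊢
    linear_combination h
  | succ n ih =>
    have h := congrArg derivative ih
    simp only [Function.iterate_succ_apply'] at h ⊢
    simp only [derivative_mul, derivative_add, derivative_sub, derivative_X_sq, derivative_one,
      derivative_C, derivative_X, derivative_zero] at h
    simp only [map_mul, map_sub, map_add, map_ofNat, map_natCast, map_one,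
      Nat.cast_add, Nat.cast_one] at h ⊢
    linear_combination h

theorem legendre_iterate_derivative (l m : ℕ) :
    derivative^[m] (legendre l) = C (1 / (2 ^ l * (l.factorial : ℝ))) *
      derivative^[l + m] ((X ^ 2 - 1) ^ l) := by
  rw [legendre, iterate_derivative_C_mul, ← Function.iterate_add_apply, add_comm]

/-- The differentiated Legendre equation. -/
theorem legendre_ode (l m : ℕ) (z : ℝ) :
    (1 - z ^ 2) * (derivative^[m + 2] (legendre l)).eval z =
      2 * (m + 1) * z * (derivative^[m + 1] (legendre l)).eval z -
        (l + m + 1) * (l - m) * (derivative^[m] (legendre l)).eval z := by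
  have h := congrArg (eval z) (rodrigues_ode l (l + m))
  simp only [legendre_iterate_derivative, eval_mul, eval_add, eval_sub, eval_pow, eval_X, eval_one,
    eval_C, eval_zero, ← add_assoc] at h ⊢
  push_cast at h
  linear_combination (-(1 / (2 ^ l * (l.factorial : ℝ)))) * h

theorem legendre_eval_one (l : ℕ) : (legendre l).eval 1 = 1 := by
  have h1 : (derivative^[l] ((X ^ 2 - 1 : ℝ[X]) ^ l)).eval 1 = l.factorial * 2 ^ l := by
    rw [← Polynomial.factorial_smul_hasseDeriv]
    rw [LinearMap.smul_apply, eval_smul, ← taylor_coeff, nsmul_eq_mul]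
    have : taylor (1 : ℝ) ((X ^ 2 - 1) ^ l) = X ^ l * (X + C 2) ^ l := by
      rw [← mul_pow, taylor_pow]
      congr 1
      simp only [map_sub, taylor_pow, taylor_X, taylor_one, C_1, map_ofNat]
      ring
    rw [this]
    have := coeff_X_pow_mul ((X + C (2 : ℝ)) ^ l) l 0
    rw [zero_add] at this
    rw [this, coeff_zero_eq_eval_zero]
    simp
  rw [legendre, eval_mul, eval_C, h1]
  have := l.factorial_ne_zero
  field_simp

theorem legendre_iterate_derivative_succ (l : ℕ) : derivative^[l + 1] (legendre l) = 0 := by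
  rw [legendre_iterate_derivative, iterate_derivative_eq_zero, mul_zero]
  have h1 : ((X ^ 2 - 1 : ℝ[X]) ^ l).natDegree ≤ l * 2 := by
    refine natDegree_pow_le_of_le l ?_
    compute_degree
  omega

theorem legendre_injOn {l l' : ℕ}
    (h : ∀ z ∈ Set.Icc (-1 : ℝ) 1, (legendre l).eval z = (legendre l').eval z) :
    l = l' := by
  have he : legendre l = legendre l' :=
    eq_of_infinite_eval_eq _ _ ((Set.Icc_infinite (by norm_num : (-1 : ℝ) < 1)).mono h)
  have h1 := legendre_ode l 0 1
  have h2 := legendre_ode l' 0 1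
  simp only [Function.iterate_zero_apply, legendre_eval_one] at h1 h2
  rw [he] at h1
  have h3 : ((l : ℝ) - l') * (l + l' + 1) = 0 := by
    push_cast at h1 h2
    linear_combination h1 - h2
  rcases mul_eq_zero.1 h3 with h | h
  · exact_mod_cast sub_eq_zero.1 h
  · have : (0 : ℝ) < l + l' + 1 := by positivity
    linarith

end Legendre

/-! ### Rotations -/

/-- The rotation by the angle `s` about the first coordinate axis. -/
def rotX (s : ℝ) : E3 ≃ₗᵢ[ℝ] E3 where
  toFun x := !₂[x 0, x 1 * Real.cos s - x 2 * Real.sin s, x 1 * Real.sin s + x 2 * Real.cos s]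
  invFun x := !₂[x 0, x 1 * Real.cos s + x 2 * Real.sin s, -(x 1 * Real.sin s) + x 2 * Real.cos s]
  map_add' x y := by
    ext i; fin_cases i <;> simp <;> ring
  map_smul' c x := by
    ext i; fin_cases i <;> simp <;> ring
  left_inv x := by
    have h := Real.sin_sq_add_cos_sq s
    ext i; fin_cases i <;> simp
    · linear_combination (x 1) * h
    · linear_combination (x 2) * h
  right_inv x := by
    have h := Real.sin_sq_add_cos_sq s
    ext i; fin_cases i <;> simp
    · linear_combination (x 1) * h
    · linear_combination (x 2) * h
  norm_map' x := by
    have h := Real.sin_sq_add_cos_sq s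
    rw [EuclideanSpace.norm_eq, EuclideanSpace.norm_eq]
    congr 1
    simp only [Fin.sum_univ_three, Real.norm_eq_abs, sq_abs]
    simp
    linear_combination (x 1 ^ 2 + x 2 ^ 2) * h

/-- The rotation by the angle `s` about the third coordinate axis. -/
def rotZ (s : ℝ) : E3 ≃ₗᵢ[ℝ] E3 where
  toFun x := !₂[x 0 * Real.cos s - x 1 * Real.sin s, x 0 * Real.sin s + x 1 * Real.cos s, x 2]
  invFun x := !₂[x 0 * Real.cos s + x 1 * Real.sin s, -(x 0 * Real.sin s) + x 1 * Real.cos s, x 2]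
  map_add' x y := by
    ext i; fin_cases i <;> simp <;> ring
  map_smul' c x := by
    ext i; fin_cases i <;> simp <;> ring
  left_inv x := by
    have h := Real.sin_sq_add_cos_sq s
    ext i; fin_cases i <;> simp
    · linear_combination (x 0) * h
    · linear_combination (x 1) * h
  right_inv x := by
    have h := Real.sin_sq_add_cos_sq s
    ext i; fin_cases i <;> simp
    · linear_combination (x 0) * h
    · linear_combination (x 1) * h
  norm_map' x := by
    have h := Real.sin_sq_add_cos_sq s
    rw [EuclideanSpace.norm_eq, EuclideanSpace.norm_eq]
    congr 1
    simp only [Fin.sum_univ_three, Real.norm_eq_abs, sq_abs]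
    simp
    linear_combination (x 0 ^ 2 + x 1 ^ 2) * h

theorem rotX_apply (s : ℝ) (x : E3) : rotX s x =
    !₂[x 0, x 1 * Real.cos s - x 2 * Real.sin s, x 1 * Real.sin s + x 2 * Real.cos s] := rfl

theorem rotZ_apply (s : ℝ) (x : E3) : rotZ s x =
    !₂[x 0 * Real.cos s - x 1 * Real.sin s, x 0 * Real.sin s + x 1 * Real.cos s, x 2] := rfl

/-- A linear isometry that preserves the orientation. -/
def IsRotation (g : E3 ≃ₗᵢ[ℝ] E3) : Prop :=
  LinearMap.det (g.toLinearEquiv : E3 →ₗ[ℝ] E3) = 1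

theorem isRotation_rotX (s : ℝ) : IsRotation (rotX s) := by
  have h := Real.sin_sq_add_cos_sq s
  rw [IsRotation, ← LinearMap.det_toMatrix (EuclideanSpace.basisFun (Fin 3) ℝ).toBasis,
    Matrix.det_fin_three]
  simp [LinearMap.toMatrix_apply, rotX_apply]
  linear_combination h

theorem isRotation_rotZ (s : ℝ) : IsRotation (rotZ s) := by
  have h := Real.sin_sq_add_cos_sq s
  rw [IsRotation, ← LinearMap.det_toMatrix (EuclideanSpace.basisFun (Fin 3) ℝ).toBasis,
    Matrix.det_fin_three]
  simp [LinearMap.toMatrix_apply, rotZ_apply]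
  linear_combination h

theorem sphere_sq_sum (x : S2) : x.1 0 ^ 2 + x.1 1 ^ 2 + x.1 2 ^ 2 = 1 := by
  have h : ‖x.1‖ = 1 := by simp
  rw [EuclideanSpace.norm_eq, Real.sqrt_eq_one] at h
  simpa [Fin.sum_univ_three] using h

/-- The north pole. -/
def north : S2 := ⟨!₂[0, 0, 1], by simp [EuclideanSpace.norm_eq, Fin.sum_univ_three]⟩

theorem inner_north (x : S2) : inner ℝ x.1 north.1 = x.1 2 := by
  simp [north, PiLp.inner_apply, Fin.sum_univ_three]

theorem inner_rotate (g : E3 ≃ₗᵢ[ℝ] E3) (x y : S2) :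
    inner ℝ (rotate g x).1 (rotate g y).1 = inner ℝ x.1 y.1 := by
  simp [rotate]

/-- Every point of the sphere is moved to the north pole by two coordinate rotations. -/
theorem exists_rotX_rotZ (y : S2) : ∃ s φ : ℝ, rotate (rotX s) (rotate (rotZ φ) y) = north := by
  have hy := sphere_sq_sum y
  obtain ⟨r, φ, hr, h0, h1⟩ : ∃ r φ : ℝ, r ^ 2 = y.1 0 ^ 2 + y.1 1 ^ 2 ∧
      y.1 0 = r * Real.cos φ ∧ y.1 1 = r * Real.sin φ := by
    refine ⟨‖(⟨y.1 0, y.1 1⟩ : ℂ)‖, Complex.arg ⟨y.1 0, y.1 1⟩, ?_, ?_, ?_⟩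
    · rw [← Complex.normSq_eq_norm_sq, Complex.normSq_mk]; ring
    · exact (Complex.norm_mul_cos_arg ⟨y.1 0, y.1 1⟩).symm
    · exact (Complex.norm_mul_sin_arg ⟨y.1 0, y.1 1⟩).symm
  obtain ⟨θ, hc, hs⟩ : ∃ θ : ℝ, y.1 2 = Real.cos θ ∧ r = Real.sin θ := by
    have hn : ‖(⟨y.1 2, r⟩ : ℂ)‖ = 1 := by
      rw [← sq_eq_sq₀ (norm_nonneg _) zero_le_one, ← Complex.normSq_eq_norm_sq, Complex.normSq_mk]
      linarith
    refine ⟨Complex.arg ⟨y.1 2, r⟩, ?_, ?_⟩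
    · have := Complex.norm_mul_cos_arg ⟨y.1 2, r⟩
      rw [hn, one_mul] at this; exact this.symm
    · have := Complex.norm_mul_sin_arg ⟨y.1 2, r⟩
      rw [hn, one_mul] at this; exact this.symm
  have hφ := Real.sin_sq_add_cos_sq φ
  have hθ := Real.sin_sq_add_cos_sq θ
  refine ⟨θ, Real.pi / 2 - φ, ?_⟩
  apply Subtype.ext
  ext i
  fin_cases i
  · simp [rotate, rotX_apply, rotZ_apply, north, h0, h1, Real.cos_pi_div_two_sub,
      Real.sin_pi_div_two_sub]
    ring
  · simp [rotate, rotX_apply, rotZ_apply, north, h0, h1, hc, Real.cos_pi_div_two_sub,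
      Real.sin_pi_div_two_sub]
    rw [← hs]
    linear_combination r * Real.cos θ * hφ
  · simp [rotate, rotX_apply, rotZ_apply, north, h0, h1, hc, Real.cos_pi_div_two_sub,
      Real.sin_pi_div_two_sub]
    rw [← hs] at hθ ⊢
    linear_combination r ^ 2 * hφ + hθ

/-! ### The addition theorem -/

section Addition

open ComplexConjugate

/-- The unnormalised spherical harmonic `(d/dz)^m Q_l(x₂) (x₀ + i x₁)^m`. -/
def solidY (l m : ℕ) (x : S2) : ℂ :=
  (((Polynomial.derivative^[m] (legendre l)).eval (x.1 2) : ℝ) : ℂ) *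
    (((x.1 0 : ℝ) : ℂ) + ((x.1 1 : ℝ) : ℂ) * Complex.I) ^ m

theorem conj_solidY_zero (l : ℕ) (x : S2) : conj (solidY l 0 x) = solidY l 0 x := by
  simp [solidY, Complex.conj_ofReal]

theorem solidY_succ_self (l : ℕ) (x : S2) : solidY l (l + 1) x = 0 := by
  simp [solidY, legendre_iterate_derivative_succ]

theorem hasDerivAt_eval_iterate_derivative (p : Polynomial ℝ) (m : ℕ) (z : ℝ) :
    HasDerivAt (fun z => (Polynomial.derivative^[m] p).eval z)
      ((Polynomial.derivative^[m + 1] p).eval z) z := by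
  rw [Function.iterate_succ_apply']
  exact Polynomial.hasDerivAt _ z

theorem hasDerivAt_rotX_coord (x : S2) (s : ℝ) :
    HasDerivAt (fun s => (rotate (rotX s) x).1 1) (-(rotate (rotX s) x).1 2) s ∧
    HasDerivAt (fun s => (rotate (rotX s) x).1 2) ((rotate (rotX s) x).1 1) s := by
  constructor
  · have h := ((Real.hasDerivAt_cos s).const_mul (x.1 1)).sub
      ((Real.hasDerivAt_sin s).const_mul (x.1 2))
    refine h.congr_deriv ?_
    simp [rotate, rotX_apply]; ring
  · have h := ((Real.hasDerivAt_sin s).const_mul (x.1 1)).add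
      ((Real.hasDerivAt_cos s).const_mul (x.1 2))
    refine h.congr_deriv ?_
    simp [rotate, rotX_apply]; ring

/-- The ladder relation, as a derivative along the rotations about the first axis. -/
theorem hasDerivAt_solidY_succ (l m : ℕ) (x : S2) (s : ℝ) :
    HasDerivAt (fun s => solidY l (m + 1) (rotate (rotX s) x))
      (-(Complex.I / 2) * (solidY l (m + 2) (rotate (rotX s) x) +
        (l + m + 1) * (l - m) * solidY l m (rotate (rotX s) x))) s := by
  obtain ⟨h1, h2⟩ := hasDerivAt_rotX_coord x s
  have hs := sphere_sq_sum (rotate (rotX s) x)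
  have ho := legendre_ode l m ((rotate (rotX s) x).1 2)
  have h3 := ((hasDerivAt_eval_iterate_derivative (legendre l) (m + 1) _).comp s h2).ofReal_comp
  have h4 := ((h1.ofReal_comp.mul_const Complex.I).const_add (((x.1 0 : ℝ) : ℂ))).pow (m + 1)
  have h5 := h3.mul h4
  refine h5.congr_deriv ?_
  have e0 : x.1 0 = (rotate (rotX s) x).1 0 := by simp [rotate, rotX_apply]
  simp only [solidY, e0, Function.comp_apply, Pi.pow_apply]
  generalize (rotate (rotX s) x).1 0 = a at *
  generalize (rotate (rotX s) x).1 1 = b at *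
  generalize (rotate (rotX s) x).1 2 = c at *
  generalize (Polynomial.derivative^[m + 2] (legendre l)).eval c = q2 at *
  generalize (Polynomial.derivative^[m + 1] (legendre l)).eval c = q1 at *
  generalize (Polynomial.derivative^[m] (legendre l)).eval c = q0 at *
  have hs' : (a : ℂ) ^ 2 + (b : ℂ) ^ 2 + (c : ℂ) ^ 2 = 1 := by
    rw [← Complex.ofReal_one, ← hs]; push_cast; rfl
  have ho' : (1 - (c : ℂ) ^ 2) * q2 = 2 * (m + 1) * c * q1 - (l + m + 1) * (l - m) * q0 := by
    exact_mod_cast ho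
  push_cast
  rw [show (a + b * Complex.I : ℂ) ^ (m + 2) =
    (a + b * Complex.I) ^ m * (a + b * Complex.I) ^ 2 by ring]
  linear_combination ((a + b * Complex.I : ℂ) ^ m * (Complex.I / 2)) * ho' +
    ((a + b * Complex.I : ℂ) ^ m * (Complex.I / 2) * q2) * hs' +
    ((a + b * Complex.I : ℂ) ^ m * q2 * (a * b + Complex.I / 2 * b ^ 2)) * Complex.I_sq

theorem hasDerivAt_solidY_zero (l : ℕ) (x : S2) (s : ℝ) :
    HasDerivAt (fun s => solidY l 0 (rotate (rotX s) x))
      (-(Complex.I / 2) * (solidY l 1 (rotate (rotX s) x) -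
        conj (solidY l 1 (rotate (rotX s) x)))) s := by
  obtain ⟨h1, h2⟩ := hasDerivAt_rotX_coord x s
  have h3 := ((hasDerivAt_eval_iterate_derivative (legendre l) 0 _).comp s h2).ofReal_comp
  have h5 : HasDerivAt (fun s => solidY l 0 (rotate (rotX s) x)) _ s :=
    h3.congr_of_eventuallyEq (Eventually.of_forall fun u => by simp [solidY])
  refine h5.congr_deriv ?_
  simp only [solidY, map_mul, map_pow, map_add, Complex.conj_ofReal, Complex.conj_I]
  push_cast
  linear_combination ((Polynomial.eval ((rotate (rotX s) x).1 2)
    (Polynomial.derivative^[1] (legendre l)) : ℝ) : ℂ) * (((rotate (rotX s) x).1 1 : ℝ) : ℂ) *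
      Complex.I_sq

/-- The coefficient `(l - m)! / (l + m)!`. -/
def facRatio (l m : ℕ) : ℝ := ((l - m).factorial : ℝ) / ((l + m).factorial : ℝ)

theorem facRatio_succ {l m : ℕ} (h : m < l) :
    facRatio l (m + 1) * ((l + m + 1) * (l - m)) = facRatio l m := by
  obtain ⟨k, rfl⟩ := Nat.exists_eq_add_of_lt h
  have e1 : m + k + 1 - m = k + 1 := by omega
  have e2 : m + k + 1 - (m + 1) = k := by omega
  have e3 : m + k + 1 + (m + 1) = m + k + 1 + m + 1 := by omega
  have h1 : ((m + k + 1 + m).factorial : ℝ) ≠ 0 := by exact_mod_cast Nat.factorial_ne_zero _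
  have h2 : ((m + k + 1 + m : ℕ) : ℝ) + 1 ≠ 0 := by positivity
  rw [facRatio, facRatio, e1, e2, e3, Nat.factorial_succ (m + k + 1 + m), Nat.factorial_succ k]
  push_cast at h2 ⊢
  field_simp
  ring

/-- The unnormalised kernel of the addition theorem. -/
def addKer (l : ℕ) (x y : S2) : ℂ :=
  solidY l 0 x * solidY l 0 y + ∑ k ∈ Finset.range l, (facRatio l (k + 1) : ℂ) *
    (solidY l (k + 1) x * conj (solidY l (k + 1) y) +
      conj (solidY l (k + 1) x) * solidY l (k + 1) y)

theorem hasDerivAt_addKer (l : ℕ) (x y : S2) (s : ℝ) :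
    HasDerivAt (fun s => addKer l (rotate (rotX s) x) (rotate (rotX s) y)) 0 s := by
  have hconj : ∀ {f : ℝ → ℂ} {f' : ℂ}, HasDerivAt f f' s →
      HasDerivAt (fun s => conj (f s)) (conj f') s :=
    fun h => h.star
  have h0 := (hasDerivAt_solidY_zero l x s).mul (hasDerivAt_solidY_zero l y s)
  have hk : ∀ k ∈ Finset.range l, HasDerivAt (fun s => (facRatio l (k + 1) : ℂ) *
      (solidY l (k + 1) (rotate (rotX s) x) * conj (solidY l (k + 1) (rotate (rotX s) y)) +
      conj (solidY l (k + 1) (rotate (rotX s) x)) * solidY l (k + 1) (rotate (rotX s) y))) _ s :=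
    fun k _ => (((hasDerivAt_solidY_succ l k x s).mul (hconj (hasDerivAt_solidY_succ l k y s))).add
      ((hconj (hasDerivAt_solidY_succ l k x s)).mul (hasDerivAt_solidY_succ l k y s))).const_mul _
  refine (h0.add (HasDerivAt.fun_sum hk)).congr_deriv ?_
  set u : ℕ → ℂ := fun m => solidY l m (rotate (rotX s) x) with hu
  set v : ℕ → ℂ := fun m => solidY l m (rotate (rotX s) y) with hv
  set A : ℕ → ℂ := fun m => -(Complex.I / 2) * ((facRatio l m : ℂ) *
    ((u (m + 1) * conj (v m) - u m * conj (v (m + 1))) -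
      (conj (u (m + 1)) * v m - conj (u m) * v (m + 1)))) with hA
  have hAl : A l = 0 := by simp [hA, hu, hv, solidY_succ_self]
  have hsum : ∑ k ∈ Finset.range l, (A (k + 1) - A k) = -A 0 := by
    rw [Finset.sum_range_sub, hAl, zero_sub]
  have hf0 : (facRatio l 0 : ℂ) = 1 := by
    have : (l.factorial : ℝ) ≠ 0 := by exact_mod_cast Nat.factorial_ne_zero _
    simp [facRatio, this]
  have hu0 : conj (u 0) = u 0 := conj_solidY_zero l _
  have hv0 : conj (v 0) = v 0 := conj_solidY_zero l _
  rw [Finset.sum_congr rfl (g := fun k => A (k + 1) - A k) fun k hk => ?_, hsum]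
  · simp only [hA, hf0, hu0, hv0]
    ring
  · have hc : (facRatio l (k + 1) : ℂ) * ((l + k + 1) * (l - k)) = facRatio l k := by
      exact_mod_cast facRatio_succ (Finset.mem_range.1 hk)
    simp only [hA]
    rw [← hc]
    simp only [map_mul, map_add, map_sub, map_neg, map_div₀, Complex.conj_I, map_natCast, map_one,
      map_ofNat]
    ring

theorem addKer_rotX (l : ℕ) (s : ℝ) (x y : S2) :
    addKer l (rotate (rotX s) x) (rotate (rotX s) y) = addKer l x y := by
  have h := is_const_of_deriv_eq_zero
    (f := fun s => addKer l (rotate (rotX s) x) (rotate (rotX s) y))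
    (fun s => (hasDerivAt_addKer l x y s).differentiableAt)
    (fun s => (hasDerivAt_addKer l x y s).deriv) s 0
  have h0 : ∀ z : S2, rotate (rotX 0) z = z := fun z => by
    apply Subtype.ext
    ext i
    fin_cases i <;> simp [rotate, rotX_apply]
  simpa only [h0] using h

theorem solidY_rotZ (l m : ℕ) (φ : ℝ) (x : S2) :
    solidY l m (rotate (rotZ φ) x) = Complex.exp (m * (φ * Complex.I)) * solidY l m x := by
  have h : (((rotate (rotZ φ) x).1 0 : ℝ) : ℂ) + (((rotate (rotZ φ) x).1 1 : ℝ) : ℂ) * Complex.I =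
      Complex.exp (φ * Complex.I) * (((x.1 0 : ℝ) : ℂ) + ((x.1 1 : ℝ) : ℂ) * Complex.I) := by
    rw [Complex.exp_mul_I]
    simp only [rotate, rotZ_apply]
    simp
    linear_combination (-(Complex.sin φ * (x.1 1 : ℂ))) * Complex.I_sq
  rw [solidY, h, mul_pow, ← Complex.exp_nat_mul, solidY]
  have h2 : (rotate (rotZ φ) x).1 2 = x.1 2 := by simp [rotate, rotZ_apply]
  rw [h2]
  ring

theorem exp_mul_conj_exp (m : ℕ) (φ : ℝ) :
    Complex.exp (m * (φ * Complex.I)) * conj (Complex.exp (m * (φ * Complex.I))) = 1 := by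
  rw [← Complex.exp_conj, ← Complex.exp_add]
  simp

theorem addKer_rotZ (l : ℕ) (φ : ℝ) (x y : S2) :
    addKer l (rotate (rotZ φ) x) (rotate (rotZ φ) y) = addKer l x y := by
  simp only [addKer, solidY_rotZ, map_mul]
  congr 1
  · simp
  · refine Finset.sum_congr rfl fun k _ => ?_
    have h := exp_mul_conj_exp (k + 1) φ
    linear_combination (facRatio l (k + 1) : ℂ) * (solidY l (k + 1) x * conj (solidY l (k + 1) y) +
      conj (solidY l (k + 1) x) * solidY l (k + 1) y) * h

theorem solidY_zero (l : ℕ) (x : S2) : solidY l 0 x = ((legendre l).eval (x.1 2) : ℝ) := by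
  simp [solidY]

theorem solidY_succ_north (l m : ℕ) : solidY l (m + 1) north = 0 := by
  simp [solidY, north]

theorem addKer_north (l : ℕ) (x : S2) : addKer l x north = ((legendre l).eval (x.1 2) : ℝ) := by
  simp only [addKer, solidY_succ_north, map_zero, mul_zero, add_zero, Finset.sum_const_zero,
    solidY_zero]
  simp [north, legendre_eval_one]

/-- The addition theorem for the unnormalised spherical harmonics. -/
theorem addKer_eq (l : ℕ) (x y : S2) :
    addKer l x y = ((legendre l).eval (inner ℝ x.1 y.1) : ℝ) := by
  obtain ⟨s, φ, h⟩ := exists_rotX_rotZ y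
  rw [← addKer_rotZ l φ, ← addKer_rotX l s, h, addKer_north, ← inner_north, ← h, inner_rotate,
    inner_rotate]

theorem sum_Icc_neg (f : ℤ → ℂ) (n : ℕ) :
    ∑ m ∈ Finset.Icc (-(n : ℤ)) n, f m =
      f 0 + ∑ k ∈ Finset.range n, (f (k + 1) + f (-(k + 1))) := by
  induction n with
  | zero => simp
  | succ n ih =>
    have : Finset.Icc (-((n + 1 : ℕ) : ℤ)) ((n + 1 : ℕ) : ℤ) =
        insert (-((n : ℤ) + 1)) (insert ((n : ℤ) + 1) (Finset.Icc (-(n : ℤ)) n)) := by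
      ext m
      simp only [Finset.mem_Icc, Finset.mem_insert]
      push_cast
      omega
    rw [this, Finset.sum_insert, Finset.sum_insert, ih, Finset.sum_range_succ]
    · ring
    · simp
    · simp only [Finset.mem_insert, Finset.mem_Icc, not_or]
      omega

/-- The normalising constant of the spherical harmonics. -/
def sphNorm (l m : ℕ) : ℝ := Real.sqrt ((2 * l + 1) / (4 * Real.pi) * facRatio l m)

theorem sphYNat_eq (l m : ℕ) (x : S2) :
    sphYNat l m x = (sphNorm l m : ℂ) * (-1) ^ m * solidY l m x := by
  rw [sphYNat, sphNorm, facRatio, solidY]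
  ring

theorem sphNorm_sq (l m : ℕ) :
    (sphNorm l m : ℂ) * sphNorm l m = ((2 * l + 1) / (4 * Real.pi) * facRatio l m : ℝ) := by
  rw [← Complex.ofReal_mul, sphNorm, Real.mul_self_sqrt]
  rw [facRatio]
  positivity

theorem sphY_zero (l : ℕ) (x : S2) : sphY l 0 x = sphNorm l 0 * solidY l 0 x := by
  simp [sphY, sphYNat_eq]

theorem sphY_pos (l k : ℕ) (x : S2) :
    sphY l (k + 1) x = sphNorm l (k + 1) * (-1) ^ (k + 1) * solidY l (k + 1) x := by
  have h1 : (0 : ℤ) ≤ k + 1 := by positivity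
  have h2 : ((k : ℤ) + 1).natAbs = k + 1 := by omega
  rw [sphY, if_pos h1, h2, sphYNat_eq]

theorem sphY_neg (l k : ℕ) (x : S2) :
    sphY l (-(k + 1)) x = sphNorm l (k + 1) * conj (solidY l (k + 1) x) := by
  have h1 : ¬ (0 : ℤ) ≤ -(k + 1) := by omega
  have h2 : (-((k : ℤ) + 1)).natAbs = k + 1 := by omega
  rw [sphY, if_neg h1, h2, sphYNat_eq]
  simp only [map_mul, map_pow, map_neg, map_one, Complex.conj_ofReal]
  have : ((-1 : ℂ) ^ (k + 1)) * (-1) ^ (k + 1) = 1 := by rw [← mul_pow]; simp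
  linear_combination (sphNorm l (k + 1) * conj (solidY l (k + 1) x)) * this

/-- The addition theorem for the spherical harmonics. -/
theorem sum_sphY_mul_conj (l : ℕ) (x y : S2) :
    ∑ m ∈ Finset.Icc (-(l : ℤ)) l, sphY l m x * conj (sphY l m y) =
      ((2 * l + 1) / (4 * Real.pi) * (legendre l).eval (inner ℝ x.1 y.1) : ℝ) := by
  rw [Complex.ofReal_mul, ← addKer_eq, sum_Icc_neg, addKer, mul_add, Finset.mul_sum]
  congr 1
  · have h := sphNorm_sq l 0
    have hf0 : facRatio l 0 = 1 := by
      have : (l.factorial : ℝ) ≠ 0 := by exact_mod_cast Nat.factorial_ne_zero _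
      simp [facRatio, this]
    rw [hf0, mul_one] at h
    rw [sphY_zero, sphY_zero, map_mul, conj_solidY_zero, Complex.conj_ofReal]
    linear_combination (solidY l 0 x * solidY l 0 y) * h
  · refine Finset.sum_congr rfl fun k _ => ?_
    have h := sphNorm_sq l (k + 1)
    rw [Complex.ofReal_mul] at h
    have h1 : ((-1 : ℂ) ^ (k + 1)) * (-1) ^ (k + 1) = 1 := by rw [← mul_pow]; simp
    simp only [sphY_pos, sphY_neg, map_mul, map_pow, map_neg, map_one, Complex.conj_ofReal,
      Complex.conj_conj]
    linear_combination (solidY l (k + 1) x * conj (solidY l (k + 1) y) +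
      conj (solidY l (k + 1) x) * solidY l (k + 1) y) * h +
      (sphNorm l (k + 1) * sphNorm l (k + 1) *
        (solidY l (k + 1) x * conj (solidY l (k + 1) y)) : ℂ) * h1

end Addition

/-! ### Invariance of the surface measure and invariant kernels -/

section Kernel

open ComplexConjugate Pointwise

instance : IsFiniteMeasure surf := by unfold surf; infer_instance

instance : surf.IsOpenPosMeasure := by unfold surf; infer_instance

theorem surf_real_univ : surf.real Set.univ = 4 * Real.pi := by
  rw [surf, Measure.toSphere_real_apply_univ, measureReal_def, EuclideanSpace.volume_ball_fin_three]
  have := Real.pi_pos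
  simp only [finrank_euclideanSpace, Fintype.card_fin, ENNReal.ofReal_one, one_pow, one_mul]
  rw [ENNReal.toReal_ofReal (by positivity)]
  push_cast
  ring

theorem continuous_rotate (g : E3 ≃ₗᵢ[ℝ] E3) : Continuous (rotate g) :=
  Continuous.subtype_mk (by fun_prop) _

theorem rotate_injective (g : E3 ≃ₗᵢ[ℝ] E3) : Function.Injective (rotate g) := fun _ _ h =>
  Subtype.ext (g.injective (congrArg Subtype.val h))

theorem measurePreserving_rotate (g : E3 ≃ₗᵢ[ℝ] E3) : MeasurePreserving (rotate g) surf surf := by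
  refine ⟨(continuous_rotate g).measurable, ?_⟩
  ext s hs
  rw [Measure.map_apply (continuous_rotate g).measurable hs, surf, Measure.toSphere_apply' _ hs,
    Measure.toSphere_apply' _ ((continuous_rotate g).measurable hs)]
  congr 1
  rw [← g.measurePreserving.measure_preimage_emb g.toHomeomorph.measurableEmbedding
    (Set.Ioo (0 : ℝ) 1 • (Subtype.val '' s))]
  congr 1
  ext v
  simp only [Set.mem_smul, Set.mem_image, Set.mem_preimage]
  constructor
  · rintro ⟨a, ha, _, ⟨x, hx, rfl⟩, rfl⟩
    exact ⟨a, ha, _, ⟨rotate g x, hx, rfl⟩, by simp [rotate]⟩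
  · rintro ⟨a, ha, _, ⟨x, hx, rfl⟩, h⟩
    have hxx : rotate g (rotate g.symm x) = x := by simp [rotate]
    refine ⟨a, ha, _, ⟨rotate g.symm x, ?_, rfl⟩, ?_⟩
    · rwa [hxx]
    · apply g.injective
      rw [← h]
      simp [rotate]

theorem integral_rotate {E : Type*} [NormedAddCommGroup E] [NormedSpace ℝ E]
    (g : E3 ≃ₗᵢ[ℝ] E3) (f : S2 → E) : ∫ z, f (rotate g z) ∂surf = ∫ z, f z ∂surf :=
  (measurePreserving_rotate g).integral_comp
    ((continuous_rotate g).isClosedEmbedding (rotate_injective g)).measurableEmbedding f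

theorem continuous_coord (i : Fin 3) : Continuous (fun x : S2 => x.1 i) := by fun_prop

theorem continuous_solidY (l m : ℕ) : Continuous (solidY l m) := by
  unfold solidY
  have h0 := continuous_coord 0
  have h1 := continuous_coord 1
  have h2 := continuous_coord 2
  fun_prop

theorem continuous_sphYNat (l m : ℕ) : Continuous (sphYNat l m) := by
  have := continuous_solidY l m
  rw [show sphYNat l m = fun x => (sphNorm l m : ℂ) * (-1) ^ m * solidY l m x from
    funext fun x => sphYNat_eq l m x]
  fun_prop

theorem continuous_sphY (l : ℕ) (m : ℤ) : Continuous (sphY l m) := by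
  have := continuous_sphYNat l m.natAbs
  unfold sphY
  split_ifs
  · exact this
  · exact continuous_const.mul (Complex.continuous_conj.comp this)

theorem sphY_rotZ (l : ℕ) (m : ℤ) (φ : ℝ) (x : S2) :
    sphY l m (rotate (rotZ φ) x) = Complex.exp (m * (φ * Complex.I)) * sphY l m x := by
  rcases le_or_gt 0 m with h | h
  · have hm : (m : ℂ) = (m.natAbs : ℂ) := by
      rw [← Int.cast_natCast, Int.natAbs_of_nonneg h]
    rw [sphY, sphY, if_pos h, if_pos h, sphYNat_eq, sphYNat_eq, solidY_rotZ, hm]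
    ring
  · have hm : (m : ℂ) = -(m.natAbs : ℂ) := by
      rw [← Int.cast_natCast, Int.ofNat_natAbs_of_nonpos h.le]; simp
    rw [sphY, sphY, if_neg (not_le.2 h), if_neg (not_le.2 h), sphYNat_eq, sphYNat_eq,
      solidY_rotZ, hm]
    simp only [map_mul, ← Complex.exp_conj, map_natCast, Complex.conj_ofReal, Complex.conj_I]
    rw [show (m.natAbs : ℂ) * (φ * -Complex.I) = -m.natAbs * (φ * Complex.I) by ring]
    ring

theorem rotate_rotZ_north (φ : ℝ) : rotate (rotZ φ) north = north := by
  apply Subtype.ext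
  ext i
  fin_cases i <;> simp [rotate, rotZ_apply, north]

theorem exp_mul_pi_div {m : ℤ} (hm : m ≠ 0) :
    Complex.exp (m * ((Real.pi / m : ℝ) * Complex.I)) = -1 := by
  have h : (m : ℂ) ≠ 0 := by exact_mod_cast hm
  rw [← Complex.exp_pi_mul_I]
  congr 1
  push_cast
  field_simp

/-- A bounded measurable kernel on the sphere that is invariant under rotations. -/
structure IsInvariantKernel (k : S2 → S2 → ℝ) : Prop where
  measurable : Measurable (Function.uncurry k)
  bounded : ∃ C, ∀ x y, |k x y| ≤ C
  invariant : ∀ g, IsRotation g → ∀ x y, k (rotate g x) (rotate g y) = k x y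

/-- The zonal kernel `Q_l(⟨x, y⟩)`. -/
def zonal (l : ℕ) (x y : S2) : ℝ := (legendre l).eval (inner ℝ x.1 y.1)

theorem zonal_comm (l : ℕ) (x y : S2) : zonal l x y = zonal l y x := by
  rw [zonal, zonal, real_inner_comm]

theorem zonal_self (l : ℕ) (x : S2) : zonal l x x = 1 := by
  simp [zonal, legendre_eval_one]

theorem zonal_eq_sum (l : ℕ) (x y : S2) :
    (zonal l x y : ℂ) = (4 * Real.pi / (2 * l + 1) : ℝ) *
      ∑ m ∈ Finset.Icc (-(l : ℤ)) l, sphY l m x * conj (sphY l m y) := by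
  rw [sum_sphY_mul_conj, ← Complex.ofReal_mul, zonal]
  congr 1
  have := Real.pi_ne_zero
  have : (2 * l + 1 : ℝ) ≠ 0 := by positivity
  field_simp

theorem abs_zonal_le_one (l : ℕ) (x y : S2) : |zonal l x y| ≤ 1 := by
  have hself : ∀ x : S2, ∑ m ∈ Finset.Icc (-(l : ℤ)) l, ‖sphY l m x‖ ^ 2 =
      (2 * l + 1) / (4 * Real.pi) := by
    intro x
    have h := sum_sphY_mul_conj l x x
    simp only [Complex.mul_conj, Complex.normSq_eq_norm_sq] at h
    rw [← Complex.ofReal_sum, Complex.ofReal_inj] at h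
    rw [h, show inner ℝ x.1 x.1 = (1 : ℝ) by simp, legendre_eval_one, mul_one]
  have h1 : ‖∑ m ∈ Finset.Icc (-(l : ℤ)) l, sphY l m x * conj (sphY l m y)‖ ≤
      (2 * l + 1) / (4 * Real.pi) := by
    calc _ ≤ ∑ m ∈ Finset.Icc (-(l : ℤ)) l, (‖sphY l m x‖ ^ 2 / 2 + ‖sphY l m y‖ ^ 2 / 2) := by
          refine (norm_sum_le _ _).trans (Finset.sum_le_sum fun m _ => ?_)
          rw [norm_mul, RCLike.norm_conj]
          nlinarith [sq_nonneg (‖sphY l m x‖ - ‖sphY l m y‖)]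
      _ = _ := by
          rw [Finset.sum_add_distrib, ← Finset.sum_div, ← Finset.sum_div, hself, hself]; ring
  rw [← Real.norm_eq_abs, ← Complex.norm_real, zonal_eq_sum, norm_mul, Complex.norm_real,
    Real.norm_of_nonneg (by positivity)]
  calc _ ≤ 4 * Real.pi / (2 * l + 1) * ((2 * l + 1) / (4 * Real.pi)) := by gcongr
    _ = 1 := by
      have := Real.pi_ne_zero
      have : (2 * l + 1 : ℝ) ≠ 0 := by positivity
      field_simp

theorem continuous_zonal (l : ℕ) : Continuous (Function.uncurry (zonal l)) := by
  unfold zonal Function.uncurry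
  fun_prop

theorem isInvariantKernel_zonal (l : ℕ) : IsInvariantKernel (zonal l) where
  measurable := (continuous_zonal l).measurable
  bounded := ⟨1, abs_zonal_le_one l⟩
  invariant g _ x y := by rw [zonal, inner_rotate, zonal]

theorem IsInvariantKernel.measurable_left {k : S2 → S2 → ℝ} (hk : IsInvariantKernel k) (y : S2) :
    Measurable (fun x => k x y) := hk.measurable.comp measurable_prodMk_right

theorem integrable_continuous_mul_bounded {f : S2 → ℂ} (hf : Continuous f) {b : S2 → ℝ}
    (hb : Measurable b) {C : ℝ} (hC : ∀ z, |b z| ≤ C) :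
    Integrable (fun z => f z * (b z : ℂ)) surf := by
  have h1 : Integrable f surf := hf.integrable_of_hasCompactSupport
    (HasCompactSupport.of_compactSpace f)
  refine h1.mul_bdd (c := C) (by fun_prop) (Eventually.of_forall fun z => ?_)
  rw [Complex.norm_real]
  exact hC z

theorem integrable_continuous {f : S2 → ℂ} (hf : Continuous f) : Integrable f surf :=
  hf.integrable_of_hasCompactSupport (HasCompactSupport.of_compactSpace f)

theorem integral_sphY_mul_kernel_north {k : S2 → S2 → ℝ} (hk : IsInvariantKernel k) (l : ℕ) {m : ℤ}
    (hm : m ≠ 0) : ∫ z, sphY l m z * (k z north : ℂ) ∂surf = 0 := by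
  have h := integral_rotate (rotZ (Real.pi / m)) (fun z => sphY l m z * (k z north : ℂ))
  have e : ∀ z, sphY l m (rotate (rotZ (Real.pi / m)) z) *
      (k (rotate (rotZ (Real.pi / m)) z) north : ℂ) = -(sphY l m z * (k z north : ℂ)) := by
    intro z
    have h1 := hk.invariant _ (isRotation_rotZ (Real.pi / m)) z north
    rw [rotate_rotZ_north] at h1
    rw [h1, sphY_rotZ, exp_mul_pi_div hm]
    ring
  simp only [e, integral_neg] at h
  exact self_eq_neg.1 h.symm

/-- The eigenvalue of an invariant kernel on the spherical harmonics of degree `l`. -/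
def kernelEig (k : S2 → S2 → ℝ) (l : ℕ) : ℝ := ∫ z, zonal l north z * k z north ∂surf

theorem integral_zonal_mul_kernel_north {k : S2 → S2 → ℝ} (hk : IsInvariantKernel k) (l : ℕ)
    (x : S2) :
    ∫ z, zonal l x z * k z north ∂surf = kernelEig k l * zonal l x north := by
  obtain ⟨C, hC⟩ := hk.bounded
  set c : ℂ := ((4 * Real.pi / (2 * l + 1) : ℝ) : ℂ) with hc
  have key : ∀ x, ((∫ z, zonal l x z * k z north ∂surf : ℝ) : ℂ) =
      c * (sphY l 0 x * conj (∫ z, sphY l 0 z * (k z north : ℂ) ∂surf)) := by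
    intro x
    rw [← integral_complex_ofReal]
    have e : ∀ z, ((zonal l x z * k z north : ℝ) : ℂ) = ∑ m ∈ Finset.Icc (-(l : ℤ)) l,
        c * (sphY l m x * conj (sphY l m z * (k z north : ℂ))) := by
      intro z
      rw [Complex.ofReal_mul, zonal_eq_sum, ← hc, Finset.mul_sum, Finset.sum_mul]
      refine Finset.sum_congr rfl fun m _ => ?_
      rw [map_mul, Complex.conj_ofReal]
      ring
    have hint : ∀ m : ℤ, Integrable (fun z => conj (sphY l m z * (k z north : ℂ))) surf := fun m =>
      (Complex.conjCLE.toContinuousLinearMap).integrable_comp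
        (integrable_continuous_mul_bounded (continuous_sphY l m) (hk.measurable_left north) (C := C) fun z => hC z north)
    simp only [e]
    rw [integral_finsetSum _ fun m _ => ((hint m).const_mul _).const_mul _]
    rw [Finset.sum_eq_single 0]
    · rw [integral_const_mul, integral_const_mul, integral_conj]
    · intro m _ hm
      rw [integral_const_mul, integral_const_mul, integral_conj,
        integral_sphY_mul_kernel_north hk l hm]
      simp
    · intro h
      exact absurd (Finset.mem_Icc.2 ⟨by simp, by simp⟩) h
  have hx := key x
  have hn := key north
  have hz : ∀ x : S2, sphY l 0 x = sphY l 0 north * zonal l x north := by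
    intro x
    rw [sphY_zero, sphY_zero, solidY_zero, solidY_zero, zonal, inner_north]
    simp [north, legendre_eval_one]
  rw [hz x] at hx
  rw [← Complex.ofReal_inj, hx, kernelEig, Complex.ofReal_mul, hn]
  ring

/-- The Funk–Hecke formula for zonal kernels. -/
theorem integral_zonal_mul_kernel {k : S2 → S2 → ℝ} (hk : IsInvariantKernel k) (l : ℕ) (x y : S2) :
    ∫ z, zonal l x z * k z y ∂surf = kernelEig k l * zonal l x y := by
  obtain ⟨s, φ, h⟩ := exists_rotX_rotZ y
  have hinv : ∀ g, IsRotation g → ∀ x y,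
      ∫ z, zonal l (rotate g x) z * k z (rotate g y) ∂surf = ∫ z, zonal l x z * k z y ∂surf := by
    intro g hg x y
    rw [← integral_rotate g]
    simp only [hk.invariant g hg, (isInvariantKernel_zonal l).invariant g hg]
  rw [← hinv _ (isRotation_rotZ φ), ← hinv _ (isRotation_rotX s), h,
    integral_zonal_mul_kernel_north hk, ← h,
    (isInvariantKernel_zonal l).invariant _ (isRotation_rotX s),
    (isInvariantKernel_zonal l).invariant _ (isRotation_rotZ φ)]

theorem exists_inner_north {u : ℝ} (hu : u ∈ Set.Icc (-1 : ℝ) 1) :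
    ∃ x : S2, x.1 0 = Real.sqrt (1 - u ^ 2) ∧ x.1 1 = 0 ∧ x.1 2 = u := by
  have h : 0 ≤ 1 - u ^ 2 := by nlinarith [hu.1, hu.2]
  refine ⟨⟨!₂[Real.sqrt (1 - u ^ 2), 0, u], ?_⟩, by simp, by simp, by simp⟩
  simp [EuclideanSpace.norm_eq, Fin.sum_univ_three, Real.sq_sqrt h]

theorem kernelEig_zonal_of_ne {l l' : ℕ} (h : l ≠ l') : kernelEig (zonal l') l = 0 := by
  have e : ∀ x y, kernelEig (zonal l') l * zonal l x y = kernelEig (zonal l) l' * zonal l' x y := by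
    intro x y
    rw [← integral_zonal_mul_kernel (isInvariantKernel_zonal l'), zonal_comm l' x y,
      ← integral_zonal_mul_kernel (isInvariantKernel_zonal l)]
    refine integral_congr_ae (Eventually.of_forall fun z => ?_)
    simp only
    rw [zonal_comm l x z, zonal_comm l' z y, mul_comm]
  have h1 := e north north
  simp only [zonal_self, mul_one] at h1
  by_contra h0
  refine h (legendre_injOn fun u hu => ?_)
  obtain ⟨x, -, -, hx⟩ := exists_inner_north hu
  have h2 := e x north
  rw [← h1] at h2
  have h3 := mul_left_cancel₀ h0 h2
  rwa [zonal, zonal, inner_north, hx] at h3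

theorem legendre_iterate_derivative_eval_one_pos {l m : ℕ} (h : m ≤ l) :
    0 < (Polynomial.derivative^[m] (legendre l)).eval 1 := by
  induction m with
  | zero => simp [legendre_eval_one]
  | succ m ih =>
    have h1 := legendre_ode l m 1
    have h2 := ih (by omega)
    have h3 : (m : ℝ) + 1 ≤ l := by exact_mod_cast h
    have h4 : 0 < (l + m + 1 : ℝ) * (l - m) :=
      mul_pos (by positivity) (by linarith)
    have h5 := mul_pos h4 h2
    have h6 : 0 < 2 * ((m : ℝ) + 1) * (Polynomial.derivative^[m + 1] (legendre l)).eval 1 := by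
      linarith
    exact pos_of_mul_pos_right h6 (by positivity)

theorem exists_solidY_ne_zero {l m : ℕ} (h : m ≤ l) : ∃ x, solidY l m x ≠ 0 := by
  have hc : ContinuousAt (fun z => (Polynomial.derivative^[m] (legendre l)).eval z) 1 :=
    (Polynomial.continuous _).continuousAt
  have h1 : ∀ᶠ z in 𝓝[<] (1 : ℝ), 0 < (Polynomial.derivative^[m] (legendre l)).eval z :=
    nhdsWithin_le_nhds (hc.eventually_const_lt (legendre_iterate_derivative_eval_one_pos h))
  have h2 : ∀ᶠ z in 𝓝[<] (1 : ℝ), 0 < z := nhdsWithin_le_nhds (lt_mem_nhds one_pos)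
  obtain ⟨z, hz1, hz2, hz3⟩ := (h1.and (h2.and self_mem_nhdsWithin)).exists
  have hz3' : z < 1 := hz3
  obtain ⟨x, hx0, hx1, hx2⟩ := exists_inner_north (u := z) ⟨by linarith, hz3'.le⟩
  refine ⟨x, ?_⟩
  have hs : 0 < Real.sqrt (1 - z ^ 2) := Real.sqrt_pos.2 (by nlinarith)
  rw [solidY, hx0, hx1, hx2]
  simp [hz1.ne', hs.ne']

theorem exists_sphY_ne_zero {l : ℕ} {m : ℤ} (h : m ∈ Finset.Icc (-(l : ℤ)) l) :
    ∃ x, sphY l m x ≠ 0 := by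
  rw [Finset.mem_Icc] at h
  obtain ⟨x, hx⟩ := exists_solidY_ne_zero (l := l) (m := m.natAbs) (by omega)
  have hn : sphNorm l m.natAbs ≠ 0 := by
    rw [sphNorm, facRatio]
    have := Real.pi_pos
    have h1 : (0 : ℝ) < (l - m.natAbs).factorial := by exact_mod_cast Nat.factorial_pos _
    have h2 : (0 : ℝ) < (l + m.natAbs).factorial := by exact_mod_cast Nat.factorial_pos _
    positivity
  refine ⟨x, ?_⟩
  have : sphYNat l m.natAbs x ≠ 0 := by
    rw [sphYNat_eq]
    exact mul_ne_zero (mul_ne_zero (by exact_mod_cast hn) (by simp)) hx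
  rw [sphY]
  split_ifs
  · exact this
  · simpa using this

theorem integrable_sphY_mul_conj (l : ℕ) (m m' : ℤ) :
    Integrable (fun z => sphY l m z * conj (sphY l m' z)) surf :=
  integrable_continuous ((continuous_sphY l m).mul
    (Complex.continuous_conj.comp (continuous_sphY l m')))

theorem integral_sphY_mul_conj_of_ne (l : ℕ) {m m' : ℤ} (h : m ≠ m') :
    ∫ z, sphY l m z * conj (sphY l m' z) ∂surf = 0 := by
  have hm : m - m' ≠ 0 := sub_ne_zero.2 h
  have h1 := integral_rotate (rotZ (Real.pi / (m - m' : ℤ)))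
    (fun z => sphY l m z * conj (sphY l m' z))
  have e : ∀ z, sphY l m (rotate (rotZ (Real.pi / (m - m' : ℤ))) z) *
      conj (sphY l m' (rotate (rotZ (Real.pi / (m - m' : ℤ))) z)) =
        -(sphY l m z * conj (sphY l m' z)) := by
    intro z
    have h2 := exp_mul_pi_div hm
    rw [sphY_rotZ, sphY_rotZ, map_mul, ← Complex.exp_conj]
    simp only [map_mul, map_intCast, Complex.conj_ofReal, Complex.conj_I]
    have h3 : Complex.exp (m * ((Real.pi / (m - m' : ℤ) : ℝ) * Complex.I)) *
        Complex.exp (m' * ((Real.pi / (m - m' : ℤ) : ℝ) * -Complex.I)) = -1 := by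
      rw [← Complex.exp_add, ← h2]
      congr 1
      push_cast
      ring
    linear_combination (sphY l m z * conj (sphY l m' z)) * h3
  simp only [e, integral_neg] at h1
  exact self_eq_neg.1 h1.symm

/-- The squared norm of a spherical harmonic. -/
def sphMass (l : ℕ) (m : ℤ) : ℝ := ∫ z, ‖sphY l m z‖ ^ 2 ∂surf

theorem integral_sphY_mul_conj_self (l : ℕ) (m : ℤ) :
    ∫ z, sphY l m z * conj (sphY l m z) ∂surf = sphMass l m := by
  simp only [Complex.mul_conj, Complex.normSq_eq_norm_sq]
  rw [integral_complex_ofReal, sphMass]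

theorem sphMass_pos {l : ℕ} {m : ℤ} (h : m ∈ Finset.Icc (-(l : ℤ)) l) : 0 < sphMass l m := by
  obtain ⟨x, hx⟩ := exists_sphY_ne_zero h
  have hc : Continuous (fun z => ‖sphY l m z‖ ^ 2) := (continuous_sphY l m).norm.pow 2
  exact hc.integral_pos_of_hasCompactSupport_nonneg_nonzero (HasCompactSupport.of_compactSpace _)
    (fun z => by positivity) (x := x) (by simpa using hx)

theorem integral_zonal_mul_sphY (l : ℕ) {m : ℤ} (hm : m ∈ Finset.Icc (-(l : ℤ)) l) (x : S2) :
    ∫ z, (zonal l x z : ℂ) * sphY l m z ∂surf =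
      (4 * Real.pi / (2 * l + 1) : ℝ) * sphMass l m * sphY l m x := by
  have e : ∀ z, (zonal l x z : ℂ) * sphY l m z = ∑ m' ∈ Finset.Icc (-(l : ℤ)) l,
      ((4 * Real.pi / (2 * l + 1) : ℝ) : ℂ) * sphY l m' x * (sphY l m z * conj (sphY l m' z)) := by
    intro z
    rw [zonal_eq_sum, Finset.mul_sum, Finset.sum_mul]
    exact Finset.sum_congr rfl fun m' _ => by ring
  simp only [e]
  rw [integral_finsetSum _ fun m' _ => (integrable_sphY_mul_conj l m m').const_mul _]
  rw [Finset.sum_eq_single m]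
  · rw [integral_const_mul, integral_sphY_mul_conj_self]; ring
  · intro m' _ h
    rw [integral_const_mul, integral_sphY_mul_conj_of_ne l h.symm, mul_zero]
  · intro h; exact absurd hm h

theorem kernelEig_zonal_eq_sphMass (l : ℕ) {m : ℤ} (hm : m ∈ Finset.Icc (-(l : ℤ)) l) :
    kernelEig (zonal l) l = 4 * Real.pi / (2 * l + 1) * sphMass l m := by
  obtain ⟨x, hx⟩ := exists_sphY_ne_zero hm
  have hpos := sphMass_pos hm
  set c : ℝ := 4 * Real.pi / (2 * l + 1) with hc
  have hc0 : 0 < c := by have := Real.pi_pos; positivity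
  have h1 : ∀ y, ∫ z, (zonal l y z : ℂ) * sphY l m z ∂surf = c * sphMass l m * sphY l m y :=
    integral_zonal_mul_sphY l hm
  have hcomp : ∀ w, ∫ z, (zonal l x z : ℂ) * zonal l z w ∂surf =
      (kernelEig (zonal l) l : ℂ) * zonal l x w := by
    intro w
    have := integral_zonal_mul_kernel (isInvariantKernel_zonal l) l x w
    rw [← Complex.ofReal_mul, ← this, ← integral_complex_ofReal]
    simp
  have hzc : Continuous (Function.uncurry (zonal l)) := continuous_zonal l
  have h2 : ∫ z, ∫ w, (zonal l x z : ℂ) * zonal l z w * sphY l m w ∂surf ∂surf =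
      ∫ w, ∫ z, (zonal l x z : ℂ) * zonal l z w * sphY l m w ∂surf ∂surf := by
    refine integral_integral_swap ?_
    have hcont : Continuous (Function.uncurry fun z w =>
        (zonal l x z : ℂ) * zonal l z w * sphY l m w) := by
      have a1 : Continuous (fun p : S2 × S2 => zonal l x p.1) :=
        hzc.comp (continuous_const.prodMk continuous_fst)
      have a2 : Continuous (fun p : S2 × S2 => zonal l p.1 p.2) := hzc
      have a3 := (continuous_sphY l m).comp (continuous_snd (X := S2))
      exact ((Complex.continuous_ofReal.comp a1).mul (Complex.continuous_ofReal.comp a2)).mul a3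
    exact hcont.integrable_of_hasCompactSupport (HasCompactSupport.of_compactSpace _)
  simp only [mul_assoc, integral_const_mul, h1] at h2
  simp only [← mul_assoc, integral_mul_const, hcomp] at h2
  simp only [mul_assoc, integral_const_mul, h1] at h2
  have e : ∫ z, (zonal l x z : ℂ) * (c * (sphMass l m * sphY l m z)) ∂surf =
      c * sphMass l m * (c * sphMass l m * sphY l m x) := by
    rw [← h1, ← integral_const_mul]
    exact integral_congr_ae (Eventually.of_forall fun z => by ring)
  rw [e] at h2
  have hg : (sphMass l m : ℂ) ≠ 0 := by exact_mod_cast hpos.ne'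
  have hcc : (c : ℂ) ≠ 0 := by exact_mod_cast hc0.ne'
  have h3 : (c * sphMass l m * sphY l m x : ℂ) * (kernelEig (zonal l) l - c * sphMass l m) = 0 := by
    linear_combination -h2
  have h4 := (mul_eq_zero.1 h3).resolve_left (mul_ne_zero (mul_ne_zero hcc hg) hx)
  exact_mod_cast sub_eq_zero.1 h4

theorem kernelEig_zonal_self (l : ℕ) : kernelEig (zonal l) l = 4 * Real.pi / (2 * l + 1) := by
  have h1 : ∑ m ∈ Finset.Icc (-(l : ℤ)) l, sphMass l m = 2 * l + 1 := by
    rw [← Complex.ofReal_inj, Complex.ofReal_sum]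
    simp only [← integral_sphY_mul_conj_self]
    rw [← integral_finsetSum _ fun m _ => integrable_sphY_mul_conj l m m]
    simp only [sum_sphY_mul_conj]
    rw [integral_complex_ofReal]
    have : ∀ x : S2, inner ℝ x.1 x.1 = (1 : ℝ) := fun x => by simp
    simp only [this, legendre_eval_one, mul_one]
    rw [integral_const, surf_real_univ, smul_eq_mul]
    congr 1
    have := Real.pi_ne_zero
    field_simp
  have h2 : ∑ m ∈ Finset.Icc (-(l : ℤ)) l, kernelEig (zonal l) l =
      4 * Real.pi / (2 * l + 1) * (2 * l + 1) := by
    rw [Finset.sum_congr rfl fun m hm => kernelEig_zonal_eq_sphMass l hm, ← Finset.mul_sum, h1]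
  have h3 : ((Finset.Icc (-(l : ℤ)) l).card : ℝ) = 2 * l + 1 := by
    rw [Int.card_Icc, show ((l : ℤ) + 1 - -l).toNat = 2 * l + 1 by omega]
    push_cast; ring
  rw [Finset.sum_const, nsmul_eq_mul, h3] at h2
  have : (2 * l + 1 : ℝ) ≠ 0 := by positivity
  rw [mul_comm] at h2
  exact mul_right_cancel₀ this h2

theorem integral_zonal_mul_zonal (l l' : ℕ) (x y : S2) :
    ∫ z, zonal l x z * zonal l' z y ∂surf =
      if l = l' then 4 * Real.pi / (2 * l + 1) * zonal l x y else 0 := by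
  rw [integral_zonal_mul_kernel (isInvariantKernel_zonal l')]
  split_ifs with h
  · rw [← h, kernelEig_zonal_self]
  · rw [kernelEig_zonal_of_ne h, zero_mul]

theorem integral_zonal_kernel_zonal {k : S2 → S2 → ℝ} (hk : IsInvariantKernel k) (l l' : ℕ)
    (x y : S2) :
    ∫ w, (∫ z, zonal l x z * k z w ∂surf) * zonal l' w y ∂surf =
      if l = l' then kernelEig k l * (4 * Real.pi / (2 * l + 1)) * zonal l x y else 0 := by
  simp only [integral_zonal_mul_kernel hk, mul_assoc, integral_const_mul, integral_zonal_mul_zonal]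
  split_ifs <;> simp

theorem integral_integral_zonal_kernel {k : S2 → S2 → ℝ} (hk : IsInvariantKernel k) (l : ℕ) :
    ∫ w, ∫ z, zonal l w z * k z w ∂surf ∂surf = 4 * Real.pi * kernelEig k l := by
  simp only [integral_zonal_mul_kernel hk, zonal_self, mul_one]
  rw [integral_const, surf_real_univ, smul_eq_mul]

end Kernel

variable {Ω : Type*} [MeasurableSpace Ω]

/-! ### Second moments of the Fourier coefficients -/

section Field

open ComplexConjugate

/-- The covariance function of the field. -/
def cov (P : Measure Ω) (T : S2 → Ω → ℝ) (x y : S2) : ℝ := ∫ ω, T x ω * T y ω ∂P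

variable {P : Measure Ω} {T : S2 → Ω → ℝ}

theorem IsIsotropicGaussianField.integrable_mul (hT : IsIsotropicGaussianField P T) (x y : S2) :
    Integrable (fun ω => T x ω * T y ω) P :=
  (hT.sq_integrable x).integrable_mul (hT.sq_integrable y)

theorem IsIsotropicGaussianField.cov_self (hT : IsIsotropicGaussianField P T) (x : S2) :
    cov P T x x = cov P T north north := by
  obtain ⟨s, φ, h⟩ := exists_rotX_rotZ x
  rw [← h, cov, cov, hT.isotropic _ (isRotation_rotX s), hT.isotropic _ (isRotation_rotZ φ)]

theorem IsIsotropicGaussianField.integral_abs_mul_le (hT : IsIsotropicGaussianField P T)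
    (x y : S2) : ∫ ω, |T x ω * T y ω| ∂P ≤ cov P T north north := by
  calc ∫ ω, |T x ω * T y ω| ∂P ≤ ∫ ω, (T x ω * T x ω / 2 + T y ω * T y ω / 2) ∂P := by
        refine integral_mono (hT.integrable_mul x y).abs
          (((hT.integrable_mul x x).div_const 2).add ((hT.integrable_mul y y).div_const 2))
          fun ω => ?_
        simp only [abs_mul]
        nlinarith [sq_nonneg (|T x ω| - |T y ω|), abs_mul_abs_self (T x ω),
          abs_mul_abs_self (T y ω)]
    _ = cov P T x x / 2 + cov P T y y / 2 := by
        rw [integral_add ((hT.integrable_mul x x).div_const 2)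
          ((hT.integrable_mul y y).div_const 2), integral_div, integral_div, cov, cov]
    _ = _ := by rw [hT.cov_self x, hT.cov_self y]; ring

theorem IsIsotropicGaussianField.abs_cov_le (hT : IsIsotropicGaussianField P T) (x y : S2) :
    |cov P T x y| ≤ cov P T north north :=
  (abs_integral_le_integral_abs).trans (hT.integral_abs_mul_le x y)

theorem IsIsotropicGaussianField.measurable_mul (hT : IsIsotropicGaussianField P T) :
    Measurable (fun p : (S2 × S2) × Ω => T p.1.1 p.2 * T p.1.2 p.2) :=
  (hT.measurable.comp ((measurable_fst.comp measurable_fst).prodMk measurable_snd)).mul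
    (hT.measurable.comp ((measurable_snd.comp measurable_fst).prodMk measurable_snd))

/-- The mean of a product is continuous in mean square. -/
theorem tendsto_integral_mul {f g : ℕ → Ω → ℝ} {f₀ g₀ : Ω → ℝ} (hf : ∀ n, MemLp (f n) 2 P)
    (hg : ∀ n, MemLp (g n) 2 P) (hf₀ : MemLp f₀ 2 P) (hg₀ : MemLp g₀ 2 P)
    (h1 : Tendsto (fun n => eLpNorm (f n - f₀) 2 P) atTop (𝓝 0))
    (h2 : Tendsto (fun n => eLpNorm (g n - g₀) 2 P) atTop (𝓝 0)) :
    Tendsto (fun n => ∫ ω, f n ω * g n ω ∂P) atTop (𝓝 (∫ ω, f₀ ω * g₀ ω ∂P)) := by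
  have k1 := (Lp.tendsto_Lp_iff_tendsto_eLpNorm'' f hf f₀ hf₀).2 h1
  have k2 := (Lp.tendsto_Lp_iff_tendsto_eLpNorm'' g hg g₀ hg₀).2 h2
  have e : ∀ {u v : Ω → ℝ} (hu : MemLp u 2 P) (hv : MemLp v 2 P),
      inner ℝ (hu.toLp u) (hv.toLp v) = ∫ ω, u ω * v ω ∂P := by
    intro u v hu hv
    rw [L2.inner_def]
    refine integral_congr_ae ?_
    filter_upwards [hu.coeFn_toLp, hv.coeFn_toLp] with ω h h'
    rw [h, h']
    simp [mul_comm]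
  have := k1.inner (𝕜 := ℝ) k2
  simpa only [e] using this

variable [IsProbabilityMeasure P]

theorem IsIsotropicGaussianField.isInvariantKernel_cov (hT : IsIsotropicGaussianField P T) :
    IsInvariantKernel (cov P T) where
  measurable := (hT.measurable_mul.stronglyMeasurable.integral_prod_right (ν := P)).measurable
  bounded := ⟨_, hT.abs_cov_le⟩
  invariant g hg x y := hT.isotropic g hg x y

section Bilinear

variable {𝕜 : Type*} [RCLike 𝕜]

theorem IsIsotropicGaussianField.integrable_prod_mul (hT : IsIsotropicGaussianField P T)
    {f g : S2 → 𝕜} (hf : Continuous f) (hg : Continuous g) :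
    Integrable (fun p : Ω × (S2 × S2) => (T p.2.1 p.1 • g p.2.1) * (T p.2.2 p.1 • f p.2.2))
      (P.prod (surf.prod surf)) := by
  obtain ⟨C, hC⟩ := (isCompact_range hf).isBounded.exists_norm_le
  obtain ⟨D, hD⟩ := (isCompact_range hg).isBounded.exists_norm_le
  have hC' : ∀ z, ‖f z‖ ≤ C := fun z => hC _ ⟨z, rfl⟩
  have hD' : ∀ z, ‖g z‖ ≤ D := fun z => hD _ ⟨z, rfl⟩
  have hC0 : 0 ≤ C := (norm_nonneg _).trans (hC' north)
  have hD0 : 0 ≤ D := (norm_nonneg _).trans (hD' north)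
  have hm1 : Measurable (fun p : Ω × (S2 × S2) => T p.2.1 p.1) :=
    hT.measurable.comp ((measurable_fst.comp measurable_snd).prodMk measurable_fst)
  have hm2 : Measurable (fun p : Ω × (S2 × S2) => T p.2.2 p.1) :=
    hT.measurable.comp ((measurable_snd.comp measurable_snd).prodMk measurable_fst)
  have hm3 : Measurable (fun p : Ω × (S2 × S2) => g p.2.1) :=
    hg.measurable.comp (measurable_fst.comp measurable_snd)
  have hm4 : Measurable (fun p : Ω × (S2 × S2) => f p.2.2) :=
    hf.measurable.comp (measurable_snd.comp measurable_snd)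
  have hm : Measurable (fun p : Ω × (S2 × S2) =>
      (T p.2.1 p.1 • g p.2.1) * (T p.2.2 p.1 • f p.2.2)) := (hm1.smul hm3).mul (hm2.smul hm4)
  rw [integrable_prod_iff' hm.aestronglyMeasurable]
  have e : ∀ (p : S2 × S2) ω, (T p.1 ω • g p.1) * (T p.2 ω • f p.2) =
      (T p.1 ω * T p.2 ω) • (g p.1 * f p.2) := fun p ω => by
    rw [smul_mul_smul_comm]
  refine ⟨Eventually.of_forall fun p => ?_, ?_⟩
  · simp only [e]
    exact (hT.integrable_mul p.1 p.2).smul_const _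
  · refine Integrable.of_bound
      (hm.norm.comp measurable_swap).stronglyMeasurable.integral_prod_right'.aestronglyMeasurable
      (cov P T north north * (D * C)) (Eventually.of_forall fun p => ?_)
    simp only [e, norm_smul, norm_mul (g _)]
    rw [integral_mul_const, norm_mul, Real.norm_of_nonneg (integral_nonneg fun ω => norm_nonneg _),
      Real.norm_of_nonneg (by positivity)]
    gcongr
    · exact (integral_nonneg fun ω => abs_nonneg _).trans (hT.integral_abs_mul_le p.1 p.2)
    · exact hT.integral_abs_mul_le p.1 p.2
    · exact hD' _
    · exact hC' _

/-- The bilinear form of the field on continuous test functions. -/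
theorem IsIsotropicGaussianField.integral_mul_integral (hT : IsIsotropicGaussianField P T)
    {f g : S2 → 𝕜} (hf : Continuous f) (hg : Continuous g) :
    Integrable (fun ω => (∫ w, T w ω • g w ∂surf) * ∫ z, T z ω • f z ∂surf) P ∧
    ∫ ω, (∫ w, T w ω • g w ∂surf) * (∫ z, T z ω • f z ∂surf) ∂P =
      ∫ w, ∫ z, cov P T w z • (g w * f z) ∂surf ∂surf := by
  have h := hT.integrable_prod_mul hf hg
  have h1 : ∀ ω, ∫ p : S2 × S2, (T p.1 ω • g p.1) * (T p.2 ω • f p.2) ∂(surf.prod surf) =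
      (∫ w, T w ω • g w ∂surf) * ∫ z, T z ω • f z ∂surf := fun ω =>
    integral_prod_mul (fun w => T w ω • g w) (fun z => T z ω • f z)
  have e : ∀ (p : S2 × S2) ω, (T p.1 ω • g p.1) * (T p.2 ω • f p.2) =
      (T p.1 ω * T p.2 ω) • (g p.1 * f p.2) := fun p ω => by
    rw [smul_mul_smul_comm]
  constructor
  · refine h.integral_prod_left.congr (Eventually.of_forall fun ω => ?_)
    exact h1 ω
  · simp only [← h1]
    rw [integral_integral_swap h, integral_prod]
    · refine integral_congr_ae (Eventually.of_forall fun w => integral_congr_ae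
        (Eventually.of_forall fun z => ?_))
      simp only [e (w, z), integral_smul_const, cov]
    · exact h.integral_prod_right

end Bilinear

theorem IsIsotropicGaussianField.ae_integrable (hT : IsIsotropicGaussianField P T) :
    ∀ᵐ ω ∂P, Integrable (fun z => T z ω) surf := by
  have hm : Measurable (fun p : Ω × S2 => T p.2 p.1) := hT.measurable.comp measurable_swap
  have h : Integrable (fun p : Ω × S2 => T p.2 p.1) (P.prod surf) := by
    rw [integrable_prod_iff' hm.aestronglyMeasurable]
    refine ⟨Eventually.of_forall fun z => (hT.sq_integrable z).integrable one_le_two, ?_⟩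
    refine Integrable.of_bound
      (hm.norm.comp measurable_swap).stronglyMeasurable.integral_prod_right'.aestronglyMeasurable
      (1 + cov P T north north) (Eventually.of_forall fun z => ?_)
    rw [Real.norm_of_nonneg (integral_nonneg fun ω => norm_nonneg _)]
    calc ∫ ω, ‖T z ω‖ ∂P ≤ ∫ ω, (1 + T z ω * T z ω) ∂P := by
          refine integral_mono ((hT.sq_integrable z).integrable one_le_two).norm
            ((integrable_const _).add (hT.integrable_mul z z)) fun ω => ?_
          simp only [Real.norm_eq_abs]
          nlinarith [sq_nonneg (|T z ω| - 1), abs_mul_abs_self (T z ω)]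
      _ = 1 + cov P T z z := by
          rw [integral_add (integrable_const _) (hT.integrable_mul z z)]
          simp [cov]
      _ = _ := by rw [hT.cov_self]
  exact h.prod_right_ae

theorem coeff_eq_smul {Ω' : Type*} (T : S2 → Ω' → ℝ) (l : ℕ) (m : ℤ) (ω : Ω') :
    coeff T l m ω = ∫ z, T z ω • conj (sphY l m z) ∂surf := by
  simp only [coeff, Complex.real_smul]

theorem conj_coeff_eq_smul {Ω' : Type*} (T : S2 → Ω' → ℝ) (l : ℕ) (m : ℤ) (ω : Ω') :
    conj (coeff T l m ω) = ∫ z, T z ω • sphY l m z ∂surf := by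
  rw [coeff, ← integral_conj]
  simp

/-- The angular power spectrum is the sequence of eigenvalues of the covariance. -/
theorem IsIsotropicGaussianField.angularPower_eq (hT : IsIsotropicGaussianField P T) (l : ℕ) :
    angularPower P T l = kernelEig (cov P T) l := by
  have hcont : ∀ m, Continuous (fun z => conj (sphY l m z)) := fun m =>
    Complex.continuous_conj.comp (continuous_sphY l m)
  have hm : ∀ m : ℤ, ((∫ ω, ‖coeff T l m ω‖ ^ 2 ∂P : ℝ) : ℂ) =
      ∫ w, ∫ z, cov P T w z • (sphY l m w * conj (sphY l m z)) ∂surf ∂surf := by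
    intro m
    rw [← (hT.integral_mul_integral (hcont m) (continuous_sphY l m)).2, ← integral_complex_ofReal]
    refine integral_congr_ae (Eventually.of_forall fun ω => ?_)
    simp only [← coeff_eq_smul, ← conj_coeff_eq_smul]
    rw [mul_comm, Complex.mul_conj, Complex.normSq_eq_norm_sq]
  have hint : ∀ m w, Integrable (fun z => cov P T w z • (sphY l m w * conj (sphY l m z))) surf := by
    intro m w
    have := integrable_continuous_mul_bounded (continuous_const.mul (hcont m) : Continuous (fun z => sphY l m w * conj (sphY l m z)))
      (hT.isInvariantKernel_cov.measurable.comp measurable_prodMk_left) (fun z => hT.abs_cov_le w z)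
    refine this.congr (Eventually.of_forall fun z => ?_)
    simp [Complex.real_smul, mul_comm]
  have hint2 : ∀ m, Integrable (fun w => ∫ z, cov P T w z • (sphY l m w * conj (sphY l m z)) ∂surf)
      surf := by
    intro m
    have h := (hT.integrable_prod_mul (hcont m) (continuous_sphY l m)).integral_prod_right
    have h2 := h.integral_prod_left
    refine h2.congr (Eventually.of_forall fun w => ?_)
    refine integral_congr_ae (Eventually.of_forall fun z => ?_)
    simp only [smul_mul_smul_comm, integral_smul_const, cov]
  have key : ((∑ m ∈ Finset.Icc (-(l : ℤ)) l, ∫ ω, ‖coeff T l m ω‖ ^ 2 ∂P : ℝ) : ℂ) =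
      ((2 * l + 1) * kernelEig (cov P T) l : ℝ) := by
    rw [Complex.ofReal_sum, Finset.sum_congr rfl fun m _ => hm m,
      ← integral_finsetSum _ fun m _ => hint2 m]
    simp only [← integral_finsetSum _ fun m _ => hint m _, ← Finset.smul_sum, sum_sphY_mul_conj]
    have e : ∀ w z, cov P T w z • (((2 * l + 1) / (4 * Real.pi) *
        (legendre l).eval (inner ℝ w.1 z.1) : ℝ) : ℂ) =
        (((2 * l + 1) / (4 * Real.pi) * (zonal l w z * cov P T z w) : ℝ) : ℂ) := by
      intro w z
      rw [Complex.real_smul, ← Complex.ofReal_mul, zonal, cov, cov]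
      simp only [mul_comm (T w _)]
      congr 1
      ring
    simp only [e, integral_complex_ofReal, integral_const_mul]
    rw [integral_integral_zonal_kernel hT.isInvariantKernel_cov]
    congr 1
    have := Real.pi_ne_zero
    field_simp
  rw [angularPower, Complex.ofReal_inj.1 key]
  have : (2 * l + 1 : ℝ) ≠ 0 := by positivity
  field_simp

theorem angularPower_nonneg (P : Measure Ω) (T : S2 → Ω → ℝ) (l : ℕ) : 0 ≤ angularPower P T l :=
  div_nonneg (Finset.sum_nonneg fun m _ => integral_nonneg fun ω => by positivity) (by positivity)

theorem IsIsotropicGaussianField.angularPower_le (hT : IsIsotropicGaussianField P T) (l : ℕ) :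
    angularPower P T l ≤ 4 * Real.pi * cov P T north north := by
  rw [hT.angularPower_eq, kernelEig]
  refine (le_abs_self _).trans ?_
  rw [← Real.norm_eq_abs]
  refine (norm_integral_le_of_norm_le_const (C := cov P T north north)
    (Eventually.of_forall fun z => ?_)).trans_eq ?_
  · rw [norm_mul]
    have h1 := abs_zonal_le_one l north z
    have h2 := hT.abs_cov_le z north
    rw [Real.norm_eq_abs, Real.norm_eq_abs]
    calc _ ≤ 1 * cov P T north north := by gcongr
      _ = _ := one_mul _
  · rw [surf_real_univ]; ring

/-- The projection of the field on degree `l`, up to the factor `(2l+1)/(4π)`. -/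
def zonalCoeff (T : S2 → Ω → ℝ) (l : ℕ) (x : S2) (ω : Ω) : ℝ := ∫ z, T z ω • zonal l x z ∂surf

theorem continuous_zonal_right (l : ℕ) (x : S2) : Continuous (zonal l x) :=
  (continuous_zonal l).comp (continuous_const.prodMk continuous_id)

theorem IsIsotropicGaussianField.integral_zonalCoeff_mul (hT : IsIsotropicGaussianField P T)
    (l l' : ℕ) (x y : S2) : ∫ ω, zonalCoeff T l x ω * zonalCoeff T l' y ω ∂P =
      if l = l' then angularPower P T l * (4 * Real.pi / (2 * l + 1)) * zonal l x y else 0 := by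
  rw [hT.angularPower_eq, ← integral_zonal_kernel_zonal hT.isInvariantKernel_cov]
  have h := (hT.integral_mul_integral (continuous_zonal_right l x) (continuous_zonal_right l' y)).2
  have hc : ∀ ω, zonalCoeff T l x ω * zonalCoeff T l' y ω =
      (∫ w, T w ω • zonal l' y w ∂surf) * (∫ z, T z ω • zonal l x z ∂surf) := fun ω => by
    rw [mul_comm]; rfl
  rw [integral_congr_ae (Eventually.of_forall hc), h]
  refine integral_congr_ae (Eventually.of_forall fun w => ?_)
  simp only [← integral_mul_const]
  refine integral_congr_ae (Eventually.of_forall fun z => ?_)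
  simp only [smul_eq_mul, cov, mul_comm (T w _), zonal_comm l' w y]
  ring

theorem IsIsotropicGaussianField.memLp_zonalCoeff (hT : IsIsotropicGaussianField P T) (l : ℕ)
    (x : S2) : MemLp (zonalCoeff T l x) 2 P := by
  have hm : Measurable (fun p : Ω × S2 => T p.2 p.1 • zonal l x p.2) :=
    (hT.measurable.comp measurable_swap).smul
      ((continuous_zonal_right l x).measurable.comp measurable_snd)
  have hm2 : StronglyMeasurable (zonalCoeff T l x) := hm.stronglyMeasurable.integral_prod_right
  rw [memLp_two_iff_integrable_sq hm2.aestronglyMeasurable]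
  refine (hT.integral_mul_integral (continuous_zonal_right l x)
    (continuous_zonal_right l x)).1.congr (Eventually.of_forall fun ω => ?_)
  simp only [zonalCoeff, sq]

/-- The real form of the partial sums of the series. -/
def realPartial (T : S2 → Ω → ℝ) (τ : ℕ → ℝ → ℝ) (L : ℕ) (t : ℝ) (x : S2) (ω : Ω) : ℝ :=
  ∑ l ∈ Finset.range (L + 1), (τ l t * ((2 * l + 1) / (4 * Real.pi))) * zonalCoeff T l x ω

theorem IsIsotropicGaussianField.partialField_ae_eq (hT : IsIsotropicGaussianField P T)
    (τ : ℕ → ℝ → ℝ) (L : ℕ) (t : ℝ) (x : S2) :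
    ∀ᵐ ω ∂P, partialField T τ L t x ω = realPartial T τ L t x ω := by
  filter_upwards [hT.ae_integrable] with ω hω
  rw [partialField, realPartial, Complex.ofReal_sum]
  refine Finset.sum_congr rfl fun l _ => ?_
  have hint : ∀ m, Integrable (fun z => T z ω • conj (sphY l m z) * sphY l m x) surf := by
    intro m
    have hc : Continuous (fun z => conj (sphY l m z)) :=
      Complex.continuous_conj.comp (continuous_sphY l m)
    obtain ⟨C, hC⟩ := (isCompact_range hc).isBounded.exists_norm_le
    refine Integrable.mul_const ?_ _
    exact hω.smul_bdd C hc.aestronglyMeasurable (Eventually.of_forall fun z => hC _ ⟨z, rfl⟩)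
  have h : ∑ m ∈ Finset.Icc (-(l : ℤ)) l, coeff T l m ω * sphY l m x =
      (((2 * l + 1) / (4 * Real.pi) * zonalCoeff T l x ω : ℝ) : ℂ) := by
    simp only [coeff_eq_smul, ← integral_mul_const]
    rw [← integral_finsetSum _ fun m _ => hint m, zonalCoeff, ← integral_const_mul,
      ← integral_complex_ofReal]
    refine integral_congr_ae (Eventually.of_forall fun z => ?_)
    have h1 := sum_sphY_mul_conj l x z
    simp only [smul_mul_assoc]
    rw [← Finset.smul_sum]
    simp only [mul_comm (conj _), h1]
    rw [Complex.real_smul, zonal, ← Complex.ofReal_mul, smul_eq_mul]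
    congr 1
    ring
  calc _ = (τ l t : ℂ) * ∑ m ∈ Finset.Icc (-(l : ℤ)) l, coeff T l m ω * sphY l m x := by
        rw [Finset.mul_sum]
        exact Finset.sum_congr rfl fun m _ => by ring
    _ = _ := by rw [h]; push_cast; ring

theorem IsIsotropicGaussianField.memLp_realPartial (hT : IsIsotropicGaussianField P T)
    (τ : ℕ → ℝ → ℝ) (L : ℕ) (t : ℝ) (x : S2) : MemLp (realPartial T τ L t x) 2 P :=
  memLp_finsetSum _ fun l _ => (hT.memLp_zonalCoeff l x).const_mul _

theorem IsIsotropicGaussianField.integral_realPartial_mul (hT : IsIsotropicGaussianField P T)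
    (τ : ℕ → ℝ → ℝ) (L : ℕ) (s t : ℝ) (x y : S2) :
    ∫ ω, realPartial T τ L s x ω * realPartial T τ L t y ω ∂P =
      ∑ l ∈ Finset.range (L + 1), (2 * l + 1) / (4 * Real.pi) * angularPower P T l *
        τ l t * τ l s * zonal l x y := by
  simp only [realPartial, Finset.sum_mul_sum]
  have hint : ∀ l l' : ℕ, Integrable (fun ω =>
      (τ l s * ((2 * l + 1) / (4 * Real.pi))) * zonalCoeff T l x ω *
        ((τ l' t * ((2 * l' + 1) / (4 * Real.pi))) * zonalCoeff T l' y ω)) P := fun l l' =>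
    ((hT.memLp_zonalCoeff l x).const_mul _).integrable_mul ((hT.memLp_zonalCoeff l' y).const_mul _)
  rw [integral_finsetSum _ fun l _ => integrable_finsetSum _ fun l' _ => hint l l']
  refine Finset.sum_congr rfl fun l hl => ?_
  rw [integral_finsetSum _ fun l' _ => hint l l', Finset.sum_eq_single l]
  · simp only [mul_mul_mul_comm _ (zonalCoeff T l x _), integral_const_mul,
      hT.integral_zonalCoeff_mul, if_true]
    have := Real.pi_ne_zero
    have : (2 * l + 1 : ℝ) ≠ 0 := by positivity
    field_simp
  · intro l' _ h
    simp only [mul_mul_mul_comm _ (zonalCoeff T l x _), integral_const_mul,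
      hT.integral_zonalCoeff_mul, if_neg h.symm, mul_zero]
  · intro h; exact absurd hl h

theorem IsIsotropicGaussianField.tendsto_realPartial (hT : IsIsotropicGaussianField P T)
    {τ : ℕ → ℝ → ℝ} {X : ℝ → S2 → Ω → ℝ} (hX : IsFieldSeries P T τ X) {t : ℝ} (ht : 0 ≤ t)
    (x : S2) :
    Tendsto (fun L => eLpNorm (realPartial T τ L t x - X t x) 2 P) atTop (𝓝 0) := by
  refine (hX t ht x).2.congr fun L => ?_
  refine eLpNorm_congr_norm_ae ?_
  filter_upwards [hT.partialField_ae_eq τ L t x] with ω hω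
  rw [hω, ← Complex.ofReal_sub, Complex.norm_real, Pi.sub_apply, norm_sub_rev]

theorem IsIsotropicGaussianField.tendsto_sum (hT : IsIsotropicGaussianField P T)
    {τ : ℕ → ℝ → ℝ} {X : ℝ → S2 → Ω → ℝ} (hX : IsFieldSeries P T τ X) {s t : ℝ} (hs : 0 ≤ s)
    (ht : 0 ≤ t) (x y : S2) :
    Tendsto (fun L => ∑ l ∈ Finset.range L, (2 * l + 1) / (4 * Real.pi) * angularPower P T l *
        τ l t * τ l s * zonal l x y) atTop (𝓝 (∫ ω, X s x ω * X t y ω ∂P)) := by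
  rw [← tendsto_add_atTop_iff_nat 1]
  have := tendsto_integral_mul (fun L => hT.memLp_realPartial τ L s x)
    (fun L => hT.memLp_realPartial τ L t y) (hX s hs x).1 (hX t ht y).1
    (hT.tendsto_realPartial hX hs x) (hT.tendsto_realPartial hX ht y)
  simpa only [hT.integral_realPartial_mul] using this

/-- The weights `(2l+1)/(4π) C_l`. -/
def weight (P : Measure Ω) (T : S2 → Ω → ℝ) (l : ℕ) : ℝ :=
  (2 * l + 1) / (4 * Real.pi) * angularPower P T l

theorem weight_nonneg (P : Measure Ω) (T : S2 → Ω → ℝ) (l : ℕ) : 0 ≤ weight P T l :=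
  mul_nonneg (div_nonneg (by positivity) (by have := Real.pi_pos; positivity))
    (angularPower_nonneg P T l)

theorem IsIsotropicGaussianField.summable_weight_mul_sq (hT : IsIsotropicGaussianField P T)
    {τ : ℕ → ℝ → ℝ} {X : ℝ → S2 → Ω → ℝ} (hX : IsFieldSeries P T τ X) {t : ℝ} (ht : 0 ≤ t) :
    Summable (fun l => weight P T l * τ l t ^ 2) := by
  have h := hT.tendsto_sum hX ht ht north north
  have hnn : ∀ l, 0 ≤ weight P T l * τ l t ^ 2 := fun l =>
    mul_nonneg (weight_nonneg P T l) (sq_nonneg _)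
  refine ((hasSum_iff_tendsto_nat_of_nonneg hnn _).2 (h.congr fun L => ?_)).summable
  refine Finset.sum_congr rfl fun l _ => ?_
  rw [zonal_self, weight]; ring

theorem IsIsotropicGaussianField.summable_abs (hT : IsIsotropicGaussianField P T)
    {τ : ℕ → ℝ → ℝ} {X : ℝ → S2 → Ω → ℝ} (hX : IsFieldSeries P T τ X) {s t : ℝ} (hs : 0 ≤ s)
    (ht : 0 ≤ t) : Summable (fun l => weight P T l * |τ l t * τ l s|) := by
  refine Summable.of_nonneg_of_le (fun l => mul_nonneg (weight_nonneg P T l) (abs_nonneg _))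
    (fun l => ?_) ((hT.summable_weight_mul_sq hX hs).add (hT.summable_weight_mul_sq hX ht))
  rw [← mul_add, abs_mul]
  refine mul_le_mul_of_nonneg_left ?_ (weight_nonneg P T l)
  nlinarith [sq_nonneg (|τ l t| - |τ l s|), sq_abs (τ l t), sq_abs (τ l s), sq_nonneg (τ l t),
    sq_nonneg (τ l s)]

/-- The covariance of the field series. -/
theorem IsIsotropicGaussianField.hasSum_lagCov (hT : IsIsotropicGaussianField P T)
    {τ : ℕ → ℝ → ℝ} {X : ℝ → S2 → Ω → ℝ} (hX : IsFieldSeries P T τ X) {t : ℝ} (ht : 0 ≤ t)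
    (x y : S2) (h : ℕ) :
    HasSum (fun l : ℕ => (2 * l + 1) / (4 * Real.pi) * angularPower P T l * τ l t * τ l (t + h) *
      zonal l x y) (lagCov P X t x y h) := by
  have hs : 0 ≤ t + h := by positivity
  have hsum : Summable (fun l : ℕ => (2 * l + 1) / (4 * Real.pi) * angularPower P T l * τ l t *
      τ l (t + h) * zonal l x y) := by
    refine Summable.of_norm_bounded (hT.summable_abs hX hs ht) fun l => ?_
    rw [Real.norm_eq_abs, abs_mul, show (2 * l + 1) / (4 * Real.pi) * angularPower P T l * τ l t *
      τ l (t + h) = weight P T l * (τ l t * τ l (t + h)) by rw [weight]; ring, abs_mul,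
      abs_of_nonneg (weight_nonneg P T l)]
    exact mul_le_of_le_one_right (mul_nonneg (weight_nonneg P T l) (abs_nonneg _))
      (abs_zonal_le_one l x y)
  have hlim := tendsto_nhds_unique hsum.hasSum.tendsto_sum_nat (hT.tendsto_sum hX hs ht x y)
  rw [lagCov, ← hlim]
  exact hsum.hasSum

end Field

/-! ### Laplace exponents -/

section Laplace

variable {M : Measure ℝ}

theorem IsSubordinatorMeasure.ae_pos (hM : IsSubordinatorMeasure M) : ∀ᵐ y ∂M, 0 < y := by
  rw [ae_iff]
  simpa [Set.Iic] using hM.pos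

theorem IsSubordinatorMeasure.integrable_one_sub_exp (hM : IsSubordinatorMeasure M) {ξ : ℝ}
    (hξ : 0 ≤ ξ) : Integrable (fun y => 1 - Real.exp (-(ξ * y))) M := by
  have h1 : Integrable (fun y : ℝ => min y 1) M := by
    refine ⟨(by fun_prop : Measurable fun y : ℝ => min y 1).aestronglyMeasurable, ?_⟩
    rw [hasFiniteIntegral_iff_ofReal]
    · exact hM.finite
    · filter_upwards [hM.ae_pos] with y hy
      exact le_min hy.le zero_le_one
  refine (h1.const_mul (max ξ 1)).mono' (by fun_prop) ?_
  filter_upwards [hM.ae_pos] with y hy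
  have h2 := Real.add_one_le_exp (-(ξ * y))
  have h3 := Real.exp_pos (-(ξ * y))
  have h4 : Real.exp (-(ξ * y)) ≤ 1 := Real.exp_le_one_iff.2 (by nlinarith)
  rw [Real.norm_of_nonneg (by linarith)]
  rcases le_total y 1 with h | h
  · rw [min_eq_left h]
    nlinarith [le_max_left ξ 1]
  · rw [min_eq_right h]
    linarith [le_max_right ξ 1]

theorem IsSubordinatorMeasure.laplaceExp_mono (hM : IsSubordinatorMeasure M) {ξ η : ℝ}
    (hξ : 0 ≤ ξ) (h : ξ ≤ η) : laplaceExp M ξ ≤ laplaceExp M η := by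
  refine integral_mono_ae (hM.integrable_one_sub_exp hξ)
    (hM.integrable_one_sub_exp (hξ.trans h)) ?_
  filter_upwards [hM.ae_pos] with y hy
  gcongr

theorem laplaceExp_zero (M : Measure ℝ) : laplaceExp M 0 = 0 := by simp [laplaceExp]

theorem IsSubordinatorMeasure.laplaceExp_nonneg (hM : IsSubordinatorMeasure M) {ξ : ℝ}
    (hξ : 0 ≤ ξ) : 0 ≤ laplaceExp M ξ := by
  simpa [laplaceExp_zero] using hM.laplaceExp_mono le_rfl hξ

theorem IsSubordinatorMeasure.laplaceExp_pos (hM : IsSubordinatorMeasure M) (h0 : M ≠ 0) {ξ : ℝ}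
    (hξ : 0 < ξ) : 0 < laplaceExp M ξ := by
  rw [laplaceExp, integral_pos_iff_support_of_nonneg_ae _ (hM.integrable_one_sub_exp hξ.le)]
  · have h1 : M (Set.Ioi 0) ≠ 0 := by
      intro h
      apply h0
      rw [← Measure.measure_univ_eq_zero, ← Set.Iic_union_Ioi (a := (0 : ℝ))]
      exact measure_union_null hM.pos h
    refine (pos_iff_ne_zero.2 h1).trans_le (measure_mono fun y hy => ?_)
    have : Real.exp (-(ξ * y)) < 1 := Real.exp_lt_one_iff.2 (neg_lt_zero.2 (mul_pos hξ hy))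
    exact (sub_pos.2 this).ne'
  · filter_upwards [hM.ae_pos] with y hy
    have : Real.exp (-(ξ * y)) ≤ 1 := Real.exp_le_one_iff.2 (neg_nonpos.2 (by positivity))
    simpa using this

theorem eig_nonneg (l : ℕ) : 0 ≤ eig l := by unfold eig; positivity

theorem eig_mono {l l' : ℕ} (h : l ≤ l') : eig l ≤ eig l' := by unfold eig; gcongr

end Laplace

variable {P : Measure Ω} {T : S2 → Ω → ℝ} {M : Measure ℝ}

/-! ### Long-range dependence -/

section LongRange

variable {γ β : ℝ}

theorem caputoCoeff_zero (hβ : 0 < β) (l : ℕ) : caputoCoeff M γ β l 0 = 1 := by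
  rw [caputoCoeff, Real.zero_rpow hβ.ne', zero_mul, neg_zero, mittagLeffler_zero]

theorem IsSubordinatorMeasure.add_laplaceExp_nonneg (hM : IsSubordinatorMeasure M) (hγ : 0 ≤ γ)
    (l : ℕ) : 0 ≤ γ + laplaceExp M (eig l) :=
  add_nonneg hγ (hM.laplaceExp_nonneg (eig_nonneg l))

theorem IsSubordinatorMeasure.caputoCoeff_pos (hM : IsSubordinatorMeasure M) (hγ : 0 ≤ γ)
    (hβ : 0 < β) (hβ1 : β < 1) (l : ℕ) {t : ℝ} (ht : 0 ≤ t) : 0 < caputoCoeff M γ β l t :=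
  mittagLeffler_neg_pos hβ hβ1
    (mul_nonneg (Real.rpow_nonneg ht _) (hM.add_laplaceExp_nonneg hγ l))

theorem IsSubordinatorMeasure.caputoCoeff_antitone (hM : IsSubordinatorMeasure M) (hγ : 0 ≤ γ)
    (hβ : 0 < β) (hβ1 : β < 1) {l l' : ℕ} (hl : l ≤ l') {t : ℝ} (ht : 0 ≤ t) :
    caputoCoeff M γ β l' t ≤ caputoCoeff M γ β l t := by
  refine mittagLeffler_neg_antitone hβ hβ1
    (mul_nonneg (Real.rpow_nonneg ht _) (hM.add_laplaceExp_nonneg hγ l)) ?_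
  have := hM.laplaceExp_mono (eig_nonneg l) (eig_mono hl)
  gcongr

theorem IsSubordinatorMeasure.le_caputoCoeff (hM : IsSubordinatorMeasure M) (hγ : 0 ≤ γ)
    (hβ : 0 < β) (hβ1 : β < 1) (l : ℕ) {t : ℝ} (ht : 0 ≤ t) :
    1 / (1 + Real.Gamma (1 - β) * t ^ β * (γ + laplaceExp M (eig l))) ≤ caputoCoeff M γ β l t := by
  rw [mul_assoc]
  exact le_mittagLeffler hβ hβ1
    (mul_nonneg (Real.rpow_nonneg ht _) (hM.add_laplaceExp_nonneg hγ l))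

theorem IsSubordinatorMeasure.lower_factor_pos (hM : IsSubordinatorMeasure M) (hγ : 0 ≤ γ)
    (hβ1 : β < 1) (l : ℕ) {t : ℝ} (ht : 0 ≤ t) :
    0 < 1 + Real.Gamma (1 - β) * t ^ β * (γ + laplaceExp M (eig l)) := by
  have h1 := Real.Gamma_pos_of_pos (show 0 < 1 - β by linarith)
  have h2 := hM.add_laplaceExp_nonneg hγ l
  positivity

theorem IsSubordinatorMeasure.lowerTerm_nonneg (hM : IsSubordinatorMeasure M) (hγ : 0 ≤ γ)
    (hβ1 : β < 1) {t : ℝ} (ht : 0 ≤ t) (h l : ℕ) : 0 ≤ lowerTerm P T M γ β t h l := by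
  have h1 := hM.lower_factor_pos hγ hβ1 l ht
  have h2 := hM.lower_factor_pos hγ hβ1 l (t := t + h) (by positivity)
  exact mul_nonneg (mul_nonneg (weight_nonneg P T l) (by positivity)) (by positivity)

theorem IsSubordinatorMeasure.lowerTerm_le (hM : IsSubordinatorMeasure M) (hγ : 0 ≤ γ)
    (hβ : 0 < β) (hβ1 : β < 1) {t : ℝ} (ht : 0 ≤ t) (h l : ℕ) :
    lowerTerm P T M γ β t h l ≤
      weight P T l * caputoCoeff M γ β l t * caputoCoeff M γ β l (t + h) := by
  have h1 := hM.lower_factor_pos hγ hβ1 l ht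
  have hth : 0 ≤ t + h := by positivity
  have h2 := hM.lower_factor_pos hγ hβ1 l hth
  have h3 := hM.le_caputoCoeff hγ hβ hβ1 l ht
  have h4 := hM.le_caputoCoeff hγ hβ hβ1 l hth
  have h5 := weight_nonneg P T l
  have h6 := hM.caputoCoeff_pos hγ hβ hβ1 l ht
  rw [lowerTerm, ← weight]
  gcongr

/-- A single term of the lower bound decays at most harmonically in the lag. -/
theorem IsSubordinatorMeasure.exists_le_lowerTerm (hM : IsSubordinatorMeasure M) (hγ : 0 ≤ γ)
    (hβ : 0 < β) (hβ1 : β < 1) {t : ℝ} (ht : 0 ≤ t) {l : ℕ} (hl : 0 < weight P T l) :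
    ∃ c : ℝ, 0 < c ∧ ∀ h : ℕ, 1 ≤ h → c * (1 / h) ≤ lowerTerm P T M γ β t h l := by
  have h1 := hM.lower_factor_pos hγ hβ1 l ht
  set K := Real.Gamma (1 - β) * (γ + laplaceExp M (eig l)) with hK
  have hK0 : 0 ≤ K := mul_nonneg (Real.Gamma_pos_of_pos (by linarith)).le
    (hM.add_laplaceExp_nonneg hγ l)
  refine ⟨weight P T l * (1 / (1 + Real.Gamma (1 - β) * t ^ β * (γ + laplaceExp M (eig l)))) *
    (1 / (1 + K * (t + 1))), by positivity, fun h hh => ?_⟩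
  have hh' : (1 : ℝ) ≤ h := by exact_mod_cast hh
  have h2 := hM.lower_factor_pos hγ hβ1 l (t := t + h) (by positivity)
  rw [lowerTerm, ← weight, mul_assoc _ (1 / (1 + K * (t + 1)))]
  refine mul_le_mul_of_nonneg_left ?_ (by positivity)
  rw [one_div_mul_one_div_rev]
  refine one_div_le_one_div_of_le h2 ?_
  have h3 : (t + h) ^ β ≤ (t + h) ^ (1 : ℝ) :=
    Real.rpow_le_rpow_of_exponent_le (by linarith) hβ1.le
  rw [Real.rpow_one] at h3
  have h4 : t + h ≤ (t + 1) * h := by nlinarith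
  have h5 : K * (t + h) ^ β ≤ K * ((t + 1) * h) := by gcongr; linarith
  calc 1 + Real.Gamma (1 - β) * (t + h) ^ β * (γ + laplaceExp M (eig l)) = 1 + K * (t + h) ^ β := by
        rw [hK]; ring
    _ ≤ h * (1 + K * (t + 1)) := by nlinarith

theorem tendsto_sum_Icc_atTop {f : ℕ → ℝ} {c : ℝ} (hc : 0 < c)
    (h : ∀ n : ℕ, 1 ≤ n → c * (1 / n) ≤ f n) :
    Tendsto (fun N : ℕ => ∑ n ∈ Finset.Icc 1 N, f n) atTop atTop := by
  refine tendsto_atTop_mono (fun N => ?_)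
    (Real.tendsto_sum_range_one_div_nat_succ_atTop.const_mul_atTop hc)
  rw [← Finset.Ico_add_one_right_eq_Icc, Finset.sum_Ico_eq_sum_range, Finset.mul_sum]
  refine Finset.sum_le_sum fun i _ => ?_
  have := h (1 + i) (by omega)
  push_cast at this
  rwa [add_comm (1 : ℝ)] at this

variable [IsProbabilityMeasure P]

theorem IsIsotropicGaussianField.summable_lowerTerm (hT : IsIsotropicGaussianField P T)
    (hM : IsSubordinatorMeasure M) (hγ : 0 ≤ γ) (hβ : 0 < β) (hβ1 : β < 1)
    {X : ℝ → S2 → Ω → ℝ} (hX : IsFieldSeries P T (caputoCoeff M γ β) X) {t : ℝ} (ht : 0 ≤ t)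
    (x : S2) (h : ℕ) :
    Summable (lowerTerm P T M γ β t h) ∧
      ∑' l : ℕ, lowerTerm P T M γ β t h l ≤ lagCov P X t x x h := by
  have h1 := hT.hasSum_lagCov hX ht x x h
  simp only [zonal_self, mul_one] at h1
  have hle := hM.lowerTerm_le (P := P) (T := T) hγ hβ hβ1 ht h
  have hs : Summable (lowerTerm P T M γ β t h) :=
    Summable.of_nonneg_of_le (hM.lowerTerm_nonneg hγ hβ1 ht h) hle h1.summable
  exact ⟨hs, (hs.tsum_le_tsum hle h1.summable).trans_eq h1.tsum_eq⟩

theorem IsIsotropicGaussianField.tendsto_sum_lowerTerm (hT : IsIsotropicGaussianField P T)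
    (hM : IsSubordinatorMeasure M) (hγ : 0 ≤ γ) (hβ : 0 < β) (hβ1 : β < 1)
    {X : ℝ → S2 → Ω → ℝ} (hX : IsFieldSeries P T (caputoCoeff M γ β) X) {t : ℝ} (ht : 0 ≤ t)
    {l : ℕ} (hl : 0 < weight P T l) :
    Tendsto (fun N : ℕ => ∑ h ∈ Finset.Icc 1 N, ∑' l : ℕ, lowerTerm P T M γ β t h l)
      atTop atTop := by
  obtain ⟨c, hc, hle⟩ := hM.exists_le_lowerTerm (β := β) hγ hβ hβ1 ht hl
  refine tendsto_sum_Icc_atTop hc fun h hh => (hle h hh).trans ?_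
  exact (hT.summable_lowerTerm hM hγ hβ hβ1 hX ht north h).1.le_tsum l
    fun j _ => hM.lowerTerm_nonneg hγ hβ1 ht h j

/-- Near the diagonal the covariance is comparable with that of a single degree. -/
theorem IsIsotropicGaussianField.exists_le_lagCov (hT : IsIsotropicGaussianField P T)
    (hM : IsSubordinatorMeasure M) (hγ : 0 ≤ γ) (hβ : 0 < β) (hβ1 : β < 1)
    {X : ℝ → S2 → Ω → ℝ} (hX : IsFieldSeries P T (caputoCoeff M γ β) X)
    {l₀ : ℕ} (hl : 0 < weight P T l₀) :
    ∃ ε : ℝ, 0 < ε ∧ ∀ t : ℝ, 0 ≤ t → ∀ x y : S2, 1 - ε < inner ℝ x.1 y.1 → ∀ h : ℕ,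
      weight P T l₀ * caputoCoeff M γ β l₀ t * caputoCoeff M γ β l₀ (t + h) / 4 ≤
        lagCov P X t x y h := by
  have hw : Summable (weight P T) := by
    have := hT.summable_weight_mul_sq hX le_rfl
    simpa only [caputoCoeff_zero hβ, one_pow, mul_one] using this
  obtain ⟨L, hL0, hL⟩ : ∃ L, l₀ < L ∧ ∑' k, weight P T (k + L) ≤ weight P T l₀ / 4 := by
    have h1 := tendsto_sum_nat_add (weight P T)
    have h2 := h1.eventually_le_const (show 0 < weight P T l₀ / 4 by positivity)
    obtain ⟨L, h3, h4⟩ := (h2.and (eventually_gt_atTop l₀)).exists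
    exact ⟨L, h4, h3⟩
  obtain ⟨ε, hε, hQ⟩ : ∃ ε : ℝ, 0 < ε ∧ ∀ u : ℝ, |u - 1| < ε → ∀ l ∈ Finset.range L,
      1 / 2 ≤ (legendre l).eval u := by
    have : ∀ᶠ u in 𝓝 (1 : ℝ), ∀ l ∈ Finset.range L, 1 / 2 ≤ (legendre l).eval u := by
      rw [Filter.eventually_all_finset]
      intro l _
      have hc : ContinuousAt (fun u => (legendre l).eval u) 1 :=
        (Polynomial.continuous _).continuousAt
      refine hc.eventually_const_le ?_
      simp only [legendre_eval_one]
      norm_num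
    obtain ⟨ε, hε, h⟩ := Metric.eventually_nhds_iff.1 this
    exact ⟨ε, hε, fun u hu => h (by rwa [Real.dist_eq])⟩
  refine ⟨ε, hε, fun t ht x y hxy h => ?_⟩
  have hth : 0 ≤ t + h := by positivity
  have hu1 : inner ℝ x.1 y.1 ≤ (1 : ℝ) := by
    have := real_inner_le_norm x.1 y.1
    simpa using this
  have hQ' := hQ (inner ℝ x.1 y.1) (by rw [abs_lt]; constructor <;> linarith)
  have hs := hT.hasSum_lagCov hX ht x y h
  set τ := caputoCoeff M γ β with hτ
  have hp : ∀ l, 0 < τ l t * τ l (t + h) := fun l =>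
    mul_pos (hM.caputoCoeff_pos hγ hβ hβ1 l ht) (hM.caputoCoeff_pos hγ hβ hβ1 l hth)
  have hterm : ∀ l : ℕ, (2 * l + 1) / (4 * Real.pi) * angularPower P T l * τ l t * τ l (t + h) *
      zonal l x y = weight P T l * (τ l t * τ l (t + h)) * zonal l x y := fun l => by
    rw [weight]; ring
  simp only [hterm] at hs
  have hsplit := hs.summable.sum_add_tsum_nat_add L
  rw [hs.tsum_eq] at hsplit
  have hhead : weight P T l₀ * (τ l₀ t * τ l₀ (t + h)) / 2 ≤
      ∑ l ∈ Finset.range L, weight P T l * (τ l t * τ l (t + h)) * zonal l x y := by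
    have h0 : ∀ l ∈ Finset.range L,
        weight P T l * (τ l t * τ l (t + h)) / 2 ≤
          weight P T l * (τ l t * τ l (t + h)) * zonal l x y := fun l hl => by
      rw [div_eq_mul_one_div]
      exact mul_le_mul_of_nonneg_left (hQ' l hl) (mul_nonneg (weight_nonneg P T l) (hp l).le)
    refine (h0 l₀ (Finset.mem_range.2 hL0)).trans ?_
    refine Finset.single_le_sum (f := fun l => weight P T l * (τ l t * τ l (t + h)) * zonal l x y)
      (fun l hl => ?_) (Finset.mem_range.2 hL0)
    refine le_trans ?_ (h0 l hl)
    exact div_nonneg (mul_nonneg (weight_nonneg P T l) (hp l).le) zero_le_two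
  have htail : -(weight P T l₀ / 4 * (τ l₀ t * τ l₀ (t + h))) ≤
      ∑' k, weight P T (k + L) * (τ (k + L) t * τ (k + L) (t + h)) * zonal (k + L) x y := by
    have hws := (summable_nat_add_iff L).2 hw
    calc -(weight P T l₀ / 4 * (τ l₀ t * τ l₀ (t + h)))
        ≤ -((∑' k, weight P T (k + L)) * (τ l₀ t * τ l₀ (t + h))) := by
          have := (hp l₀).le
          gcongr
      _ = ∑' k, -(weight P T (k + L) * (τ l₀ t * τ l₀ (t + h))) := by
          rw [tsum_neg, tsum_mul_right]
      _ ≤ _ := by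
          refine Summable.tsum_le_tsum (fun k => ?_) (hws.mul_right _).neg
            ((summable_nat_add_iff L).2 hs.summable)
          have hkl : l₀ ≤ k + L := by omega
          have h1 : τ (k + L) t * τ (k + L) (t + h) ≤ τ l₀ t * τ l₀ (t + h) :=
            mul_le_mul (hM.caputoCoeff_antitone hγ hβ hβ1 hkl ht)
              (hM.caputoCoeff_antitone hγ hβ hβ1 hkl hth)
              (hM.caputoCoeff_pos hγ hβ hβ1 _ hth).le (hM.caputoCoeff_pos hγ hβ hβ1 _ ht).le
          have h2 : weight P T (k + L) * (τ (k + L) t * τ (k + L) (t + h)) ≤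
              weight P T (k + L) * (τ l₀ t * τ l₀ (t + h)) :=
            mul_le_mul_of_nonneg_left h1 (weight_nonneg P T _)
          have h3 : 0 ≤ weight P T (k + L) * (τ (k + L) t * τ (k + L) (t + h)) :=
            mul_nonneg (weight_nonneg P T _) (hp _).le
          have h4 := abs_le.1 (abs_zonal_le_one (k + L) x y)
          nlinarith [h4.1]
  rw [← hsplit]
  linarith

end LongRange

/-! ### Short-range dependence -/

section ShortRange

variable {γ φ β : ℝ}

/-- The symbol `γ + φ ξ + Ψ(ξ)`. -/
def symbol (M : Measure ℝ) (γ φ ξ : ℝ) : ℝ := γ + φ * ξ + laplaceExp M ξ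

theorem IsSubordinatorMeasure.symbol_mono (hM : IsSubordinatorMeasure M) (hφ : 0 ≤ φ) {ξ η : ℝ}
    (hξ : 0 ≤ ξ) (h : ξ ≤ η) : symbol M γ φ ξ ≤ symbol M γ φ η := by
  have := hM.laplaceExp_mono hξ h
  unfold symbol
  gcongr

theorem IsSubordinatorMeasure.symbol_pos (hM : IsSubordinatorMeasure M) (hγ : 0 ≤ γ) (hφ : 0 ≤ φ)
    (h : 0 < γ ∨ 0 < φ ∨ M ≠ 0) {ξ : ℝ} (hξ : 0 < ξ) : 0 < symbol M γ φ ξ := by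
  have h1 := hM.laplaceExp_nonneg hξ.le
  unfold symbol
  rcases h with h | h | h
  · positivity
  · positivity
  · have := hM.laplaceExp_pos h hξ
    positivity

theorem sq_le_eig (l : ℕ) : (l : ℝ) ^ 2 ≤ eig l := by
  unfold eig
  nlinarith [Nat.cast_nonneg (α := ℝ) l]

theorem upperTerm_eq (P : Measure Ω) (T : S2 → Ω → ℝ) (t : ℝ) (x y : S2) (l : ℕ) :
    upperTerm P T M γ φ β t x y l = weight P T l * (1 / (Real.exp ((l : ℝ) ^ 2) - 1)) *
      Real.exp (-(2 * t * (l : ℝ) ^ 2)) * symbol M γ φ ((l : ℝ) ^ 2) ^ (-(2 * β)) *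
      |zonal l x y| := by
  rw [upperTerm, weight, symbol, zonal]
  ring

theorem summable_div_exp_sq_sub_one :
    Summable (fun l : ℕ => (2 * ((l + 1 : ℕ) : ℝ) + 1) / (Real.exp (((l + 1 : ℕ) : ℝ) ^ 2) - 1)) := by
  have h1 : Summable (fun l : ℕ => 6 * (1 / ((l + 1 : ℕ) : ℝ) ^ 2)) :=
    ((summable_nat_add_iff 1).2 (Real.summable_one_div_nat_pow.2 one_lt_two)).mul_left 6
  refine Summable.of_nonneg_of_le (fun l => ?_) (fun l => ?_) h1
  · have := Real.add_one_le_exp (((l + 1 : ℕ) : ℝ) ^ 2)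
    exact div_nonneg (by positivity) (by nlinarith [sq_nonneg ((l + 1 : ℕ) : ℝ)])
  · have hn : (1 : ℝ) ≤ ((l + 1 : ℕ) : ℝ) := by exact_mod_cast Nat.succ_pos l
    generalize ((l + 1 : ℕ) : ℝ) = n at *
    have h2 := Real.quadratic_le_exp_of_nonneg (sq_nonneg n)
    have h3 : 0 < n ^ 2 := by positivity
    have h4 : n ^ 2 ≤ (n ^ 2) ^ 2 := by
      rw [← pow_mul]
      exact pow_le_pow_right₀ hn (by norm_num)
    rw [mul_one_div, div_le_div_iff₀ (by nlinarith) h3]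
    have h5 : (2 * n + 1) * n ^ 2 ≤ 3 * (n ^ 2) ^ 2 := by nlinarith [mul_pos h3 h3]
    nlinarith

/-- A geometric sum with ratio `e^{-μ}`. -/
theorem sum_exp_neg_pow_le {μ : ℝ} (hμ : 0 < μ) (N : ℕ) :
    ∑ h ∈ Finset.range N, Real.exp (-μ) ^ (h + 1) ≤ 1 / (Real.exp μ - 1) := by
  have hr : Real.exp (-μ) < 1 := Real.exp_lt_one_iff.2 (by linarith)
  have h0 := Real.exp_pos (-μ)
  have h1 := (summable_geometric_of_lt_one h0.le hr).mul_left (Real.exp (-μ))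
  have h2 := h1.sum_le_tsum (Finset.range N) fun h _ => by positivity
  rw [tsum_mul_left, tsum_geometric_of_lt_one h0.le hr] at h2
  simp only [pow_succ']
  refine h2.trans_eq ?_
  have h3 : Real.exp μ * Real.exp (-μ) = 1 := by rw [← Real.exp_add]; simp
  have h4 : 1 < Real.exp μ := Real.one_lt_exp_iff.2 hμ
  rw [← div_eq_mul_inv, div_eq_div_iff (by linarith) (by linarith)]
  linarith

theorem IsSubordinatorMeasure.mul_powerCoeff (hM : IsSubordinatorMeasure M) (hγ : 0 ≤ γ)
    (hφ : 0 ≤ φ) (h : 0 < γ ∨ 0 < φ ∨ M ≠ 0) {l : ℕ} (hl : 0 < eig l) (t : ℝ) (n : ℕ) :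
    powerCoeff M γ φ β l t * powerCoeff M γ φ β l (t + n) =
      Real.exp (-(2 * t * eig l)) * symbol M γ φ (eig l) ^ (-(2 * β)) * Real.exp (-eig l) ^ n := by
  have hp := hM.symbol_pos hγ hφ h hl
  have e1 : symbol M γ φ (eig l) ^ (-(2 * β)) =
      symbol M γ φ (eig l) ^ (-β) * symbol M γ φ (eig l) ^ (-β) := by
    rw [← Real.rpow_add hp]; congr 1; ring
  have e2 : Real.exp (-(t * eig l)) * Real.exp (-((t + n) * eig l)) =
      Real.exp (-(2 * t * eig l)) * Real.exp (-eig l) ^ n := by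
    rw [← Real.exp_nat_mul, ← Real.exp_add, ← Real.exp_add]; congr 1; ring
  rw [powerCoeff, powerCoeff, ← symbol, e1]
  linear_combination (symbol M γ φ (eig l) ^ (-β) * symbol M γ φ (eig l) ^ (-β)) * e2

/-- The common factor of the covariances of degree `l`. -/
def baseTerm (P : Measure Ω) (T : S2 → Ω → ℝ) (M : Measure ℝ) (γ φ β t : ℝ) (x y : S2)
    (l : ℕ) : ℝ :=
  weight P T l * Real.exp (-(2 * t * eig l)) * symbol M γ φ (eig l) ^ (-(2 * β)) * |zonal l x y|

theorem IsSubordinatorMeasure.baseTerm_mul_le (hM : IsSubordinatorMeasure M) (hγ : 0 ≤ γ)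
    (hφ : 0 ≤ φ) (hβ : 0 < β) (h : 0 < γ ∨ 0 < φ ∨ M ≠ 0) {t : ℝ} (ht : 0 ≤ t) (x y : S2) (l N : ℕ) :
    ∑ n ∈ Finset.range N, baseTerm P T M γ φ β t x y (l + 1) * Real.exp (-eig (l + 1)) ^ (n + 1) ≤
      upperTerm P T M γ φ β t x y (l + 1) := by
  have hn : (1 : ℝ) ≤ ((l + 1 : ℕ) : ℝ) := by exact_mod_cast Nat.succ_pos l
  have hn2 : (0 : ℝ) < ((l + 1 : ℕ) : ℝ) ^ 2 := by positivity
  have hle := sq_le_eig (l + 1)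
  have hμ : 0 < eig (l + 1) := hn2.trans_le hle
  have hsp := hM.symbol_pos hγ hφ h hn2
  have hsp' := hM.symbol_pos hγ hφ h hμ
  have hw := weight_nonneg P T (l + 1)
  have he : 0 < Real.exp (((l + 1 : ℕ) : ℝ) ^ 2) - 1 := sub_pos.2 (Real.one_lt_exp_iff.2 hn2)
  have hb : 0 ≤ baseTerm P T M γ φ β t x y (l + 1) := by unfold baseTerm; positivity
  have h1 : symbol M γ φ (eig (l + 1)) ^ (-(2 * β)) ≤
      symbol M γ φ (((l + 1 : ℕ) : ℝ) ^ 2) ^ (-(2 * β)) :=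
    Real.rpow_le_rpow_of_nonpos hsp (hM.symbol_mono hφ hn2.le hle) (by linarith)
  rw [← Finset.mul_sum, upperTerm_eq]
  calc _ ≤ baseTerm P T M γ φ β t x y (l + 1) * (1 / (Real.exp (((l + 1 : ℕ) : ℝ) ^ 2) - 1)) := by
        refine mul_le_mul_of_nonneg_left ((sum_exp_neg_pow_le hμ N).trans ?_) hb
        gcongr
    _ ≤ (weight P T (l + 1) * Real.exp (-(2 * t * ((l + 1 : ℕ) : ℝ) ^ 2)) *
          symbol M γ φ (((l + 1 : ℕ) : ℝ) ^ 2) ^ (-(2 * β)) * |zonal (l + 1) x y|) *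
          (1 / (Real.exp (((l + 1 : ℕ) : ℝ) ^ 2) - 1)) := by
        unfold baseTerm
        gcongr
    _ = _ := by ring

variable [IsProbabilityMeasure P]

theorem IsIsotropicGaussianField.summable_upperTerm (hT : IsIsotropicGaussianField P T)
    (hM : IsSubordinatorMeasure M) (hγ : 0 ≤ γ) (hφ : 0 ≤ φ) (hβ : 0 < β)
    (h : 0 < γ ∨ 0 < φ ∨ M ≠ 0) {t : ℝ} (ht : 0 ≤ t) (x y : S2) :
    Summable (fun l : ℕ => upperTerm P T M γ φ β t x y (l + 1)) := by
  have hs1 := hM.symbol_pos hγ hφ h one_pos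
  refine Summable.of_nonneg_of_le (fun l => ?_) (fun l => ?_)
    (summable_div_exp_sq_sub_one.mul_left
      (cov P T north north * symbol M γ φ 1 ^ (-(2 * β))))
  all_goals
    have hn : (1 : ℝ) ≤ ((l + 1 : ℕ) : ℝ) := by exact_mod_cast Nat.succ_pos l
    have hn2 : (1 : ℝ) ≤ ((l + 1 : ℕ) : ℝ) ^ 2 := by nlinarith
    have hsp := hM.symbol_pos hγ hφ h (zero_lt_one.trans_le hn2)
    have he : 0 < Real.exp (((l + 1 : ℕ) : ℝ) ^ 2) - 1 :=
      sub_pos.2 (Real.one_lt_exp_iff.2 (by linarith))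
    have hw := weight_nonneg P T (l + 1)
    rw [upperTerm_eq]
  · positivity
  · have h1 : Real.exp (-(2 * t * ((l + 1 : ℕ) : ℝ) ^ 2)) ≤ 1 :=
      Real.exp_le_one_iff.2 (neg_nonpos.2 (by positivity))
    have h2 : symbol M γ φ (((l + 1 : ℕ) : ℝ) ^ 2) ^ (-(2 * β)) ≤ symbol M γ φ 1 ^ (-(2 * β)) :=
      Real.rpow_le_rpow_of_nonpos hs1 (hM.symbol_mono hφ zero_le_one hn2) (by linarith)
    have h3 := abs_zonal_le_one (l + 1) x y
    have h4 : weight P T (l + 1) ≤ (2 * ((l + 1 : ℕ) : ℝ) + 1) * cov P T north north := by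
      rw [weight]
      have := hT.angularPower_le (l + 1)
      have hpi := Real.pi_pos
      calc _ ≤ (2 * ((l + 1 : ℕ) : ℝ) + 1) / (4 * Real.pi) *
            (4 * Real.pi * cov P T north north) := by gcongr
        _ = _ := by field_simp
    calc _ ≤ ((2 * ((l + 1 : ℕ) : ℝ) + 1) * cov P T north north) *
          (1 / (Real.exp (((l + 1 : ℕ) : ℝ) ^ 2) - 1)) * 1 * symbol M γ φ 1 ^ (-(2 * β)) * 1 := by
          have := hw.trans h4
          gcongr
      _ = _ := by ring

theorem IsIsotropicGaussianField.sum_abs_lagCov_le (hT : IsIsotropicGaussianField P T)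
    (hM : IsSubordinatorMeasure M) (hγ : 0 ≤ γ) (hφ : 0 ≤ φ) (hβ : 0 < β)
    (h : 0 < γ ∨ 0 < φ ∨ M ≠ 0) (h0 : angularPower P T 0 = 0) {X : ℝ → S2 → Ω → ℝ}
    (hX : IsFieldSeries P T (powerCoeff M γ φ β) X) {t : ℝ} (ht : 0 ≤ t) (x y : S2) (N : ℕ) :
    ∑ n ∈ Finset.range N, |lagCov P X t x y (n + 1)| ≤
      ∑' l : ℕ, upperTerm P T M γ φ β t x y (l + 1) := by
  have hU := hT.summable_upperTerm hM hγ hφ hβ h ht x y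
  have hμ : ∀ l : ℕ, 0 < eig (l + 1) := fun l => by unfold eig; positivity
  have hb : ∀ l, 0 ≤ baseTerm P T M γ φ β t x y (l + 1) := fun l => by
    have := hM.symbol_pos hγ hφ h (hμ l)
    have := weight_nonneg P T (l + 1)
    unfold baseTerm
    positivity
  have hF : ∀ n, Summable fun l : ℕ =>
      baseTerm P T M γ φ β t x y (l + 1) * Real.exp (-eig (l + 1)) ^ (n + 1) := fun n => by
    refine Summable.of_nonneg_of_le (fun l => mul_nonneg (hb l) (by positivity)) (fun l => ?_) hU
    refine le_trans ?_ (hM.baseTerm_mul_le hγ hφ hβ h ht x y l (n + 1))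
    exact Finset.single_le_sum (f := fun n => baseTerm P T M γ φ β t x y (l + 1) *
      Real.exp (-eig (l + 1)) ^ (n + 1)) (fun n _ => mul_nonneg (hb l) (by positivity))
      (Finset.self_mem_range_succ n)
  have hcov : ∀ n, |lagCov P X t x y (n + 1)| ≤
      ∑' l : ℕ, baseTerm P T M γ φ β t x y (l + 1) * Real.exp (-eig (l + 1)) ^ (n + 1) := by
    intro n
    have hs := hT.hasSum_lagCov hX ht x y (n + 1)
    have hs' := (hasSum_nat_add_iff' 1).2 hs
    simp only [Finset.sum_range_one, h0, mul_zero, zero_mul, sub_zero] at hs'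
    rw [← hs'.tsum_eq, ← Real.norm_eq_abs]
    refine tsum_of_norm_bounded (hF n).hasSum fun l => ?_
    rw [mul_assoc (_ * angularPower P T (l + 1)), hM.mul_powerCoeff hγ hφ h (hμ l),
      Real.norm_eq_abs, abs_mul, ← weight, abs_of_nonneg]
    · refine le_of_eq ?_
      rw [baseTerm]; ring
    · have := hM.symbol_pos hγ hφ h (hμ l)
      have := weight_nonneg P T (l + 1)
      positivity
  calc _ ≤ ∑ n ∈ Finset.range N, ∑' l : ℕ,
        baseTerm P T M γ φ β t x y (l + 1) * Real.exp (-eig (l + 1)) ^ (n + 1) :=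
        Finset.sum_le_sum fun n _ => hcov n
    _ = ∑' l : ℕ, ∑ n ∈ Finset.range N,
        baseTerm P T M γ φ β t x y (l + 1) * Real.exp (-eig (l + 1)) ^ (n + 1) :=
        (Summable.tsum_finsetSum fun n _ => hF n).symm
    _ ≤ _ := Summable.tsum_le_tsum (hM.baseTerm_mul_le hγ hφ hβ h ht x y · N)
        (summable_sum fun n _ => hF n) hU

end ShortRange

end SphereField

end

open SphereField in
theorem mainTheorem5 {Ω : Type*} [MeasurableSpace Ω] (P : Measure Ω) [IsProbabilityMeasure P]
    (T : S2 → Ω → ℝ) (hT : IsIsotropicGaussianField P T)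
    (M : Measure ℝ) (hM : IsSubordinatorMeasure M) :
    -- the lower bound for the Mittag-Leffler function
    (∀ β z : ℝ, 0 < β → β < 1 → 0 ≤ z →
      1 / (1 + Real.Gamma (1 - β) * z) ≤ mittagLeffler β (-z)) ∧
    -- long-range dependence
    (∀ γ β : ℝ, 0 ≤ γ → 0 < β → β < 1 → ∀ X : ℝ → S2 → Ω → ℝ,
      IsFieldSeries P T (caputoCoeff M γ β) X →
      (∀ t : ℝ, 0 ≤ t → ∀ x y : S2, ∀ h : ℕ,
        HasSum (fun l : ℕ => (2 * l + 1) / (4 * Real.pi) * angularPower P T l *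
            caputoCoeff M γ β l t * caputoCoeff M γ β l (t + h) *
            (legendre l).eval (inner ℝ x.1 y.1))
          (lagCov P X t x y h)) ∧
      (∀ t : ℝ, 0 ≤ t → ∀ x : S2, ∀ h : ℕ,
        Summable (lowerTerm P T M γ β t h) ∧
        ∑' l : ℕ, lowerTerm P T M γ β t h l ≤ lagCov P X t x x h) ∧
      ((∃ l : ℕ, angularPower P T l ≠ 0) →
        (∀ t : ℝ, 0 ≤ t →
          Tendsto (fun N : ℕ => ∑ h ∈ Finset.Icc 1 N, ∑' l : ℕ, lowerTerm P T M γ β t h l)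
            atTop atTop) ∧
        ∃ ε : ℝ, 0 < ε ∧ ∀ t : ℝ, 0 ≤ t → ∀ x y : S2, 1 - ε < inner ℝ x.1 y.1 →
          Tendsto (fun N : ℕ => ∑ h ∈ Finset.Icc 1 N, lagCov P X t x y h) atTop atTop)) ∧
    -- short-range dependence
    (∀ γ φ β : ℝ, 0 ≤ γ → 0 ≤ φ → 0 < β → β ≤ 1 → (0 < γ ∨ 0 < φ ∨ M ≠ 0) →
      angularPower P T 0 = 0 → ∀ X : ℝ → S2 → Ω → ℝ,
      IsFieldSeries P T (powerCoeff M γ φ β) X →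
      ∀ t : ℝ, 0 ≤ t → ∀ x y : S2,
        (∀ h : ℕ,
          HasSum (fun l : ℕ => (2 * l + 1) / (4 * Real.pi) * angularPower P T l *
              powerCoeff M γ φ β l t * powerCoeff M γ φ β l (t + h) *
              (legendre l).eval (inner ℝ x.1 y.1))
            (lagCov P X t x y h)) ∧
        Summable (fun h : ℕ => |lagCov P X t x y (h + 1)|) ∧
        Summable (fun l : ℕ => upperTerm P T M γ φ β t x y (l + 1)) ∧
        ∑' h : ℕ, |lagCov P X t x y (h + 1)| ≤
          ∑' l : ℕ, upperTerm P T M γ φ β t x y (l + 1)) := by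
  refine ⟨fun β z hβ hβ1 hz => le_mittagLeffler hβ hβ1 hz, ?_, ?_⟩
  · intro γ β hγ hβ hβ1 X hX
    refine ⟨fun t ht x y h => hT.hasSum_lagCov hX ht x y h,
      fun t ht x h => hT.summable_lowerTerm hM hγ hβ hβ1 hX ht x h, ?_⟩
    rintro ⟨l, hl⟩
    have hw : 0 < weight P T l := by
      have h1 := (angularPower_nonneg P T l).lt_of_ne hl.symm
      have := Real.pi_pos
      unfold weight
      positivity
    refine ⟨fun t ht => hT.tendsto_sum_lowerTerm hM hγ hβ hβ1 hX ht hw, ?_⟩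
    obtain ⟨ε, hε, hle⟩ := hT.exists_le_lagCov hM hγ hβ hβ1 hX hw
    refine ⟨ε, hε, fun t ht x y hxy => ?_⟩
    obtain ⟨c, hc, hcl⟩ := hM.exists_le_lowerTerm (β := β) hγ hβ hβ1 ht hw
    refine tendsto_sum_Icc_atTop (c := c / 4) (by positivity) fun h hh => ?_
    have h1 := (hcl h hh).trans (hM.lowerTerm_le hγ hβ hβ1 ht h l)
    refine le_trans ?_ (hle t ht x y hxy h)
    linarith
  · intro γ φ β hγ hφ hβ _ hpos h0 X hX t ht x y
    have hle := hT.sum_abs_lagCov_le hM hγ hφ hβ hpos h0 hX ht x y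
    exact ⟨fun h => hT.hasSum_lagCov hX ht x y h,
      summable_of_sum_range_le (fun _ => abs_nonneg _) hle,
      hT.summable_upperTerm hM hγ hφ hβ hpos ht x y,
      Real.tsum_le_of_sum_range_le (fun _ => abs_nonneg _) hle⟩
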